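/- A convex $n$-polytope is a bounded intersection $K\subset\mathbb{R}^n$ of finitely many closed half-spaces with non-empty interior; it is simple if each of its vertices lies on exactly $n$ facets. Let $\mu_K$ be Lebesgue measure on $K$, normalized to total mass $1$. A $t$-cubature formula on $K$ is a finite set $F\subset\mathbb{R}^n$ with weights $w_p\in\mathbb{R}$ $(p\in F)$ such that $\int P\,d\mu_K=\sum_{p\in F}w_pP(p)$ for every real polynomial $P$ of degree at most $t$. It is positive if all $w_p>0$; interior if every $p\in F$ is in the interior of the support of $\mu_K$ (the support is $K$); boundary if every $p \in F$ is in this support and some $p \in F$ is on its boundary. A $t$-design on $K$ is a $t$-cubature formula with all weights equal that is interior or boundary. Let $K\subset\mathbb{R}^n$ be a convex $n$-polytope with facets $\Phi_1,\dots,\Phi_N$, and let $x_k$ be the distance of $x \in K$ to the hyperplane spanned by $\Phi_k$. Let $d$ be the distance on $K$ defined by $$ds^2=\frac{dx_1^2}{x_1}+\frac{dx_2^2}{x_2}+\dots+\frac{dx_N^2}{x_N},$$ that is, $d(x,y)$ is the infimum of $\int ds$ over $C^1$ curves in $K$ from $x$ to $y$ (with $0/0=0$). Then there are constants $C,C',c>0$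 that depend only on $K$ such that the following hold for every integer $t\ge 1$. 1. If $K$ is simple, then every $t$-cubature formula $F$ on $K$ that is positive and interior, or positive and boundary, is an $\epsilon$-net of $K$ with respect to $d$ with $\epsilon=C/t$: every point of $K$ is at $d$-distance at most $C/t$ from a point of $F$. 2. The least weight of every positive $t$-cubature formula on $K$ (its points need not lie in $K$) is at most $C't^{-2n}$. 3. Every $t$-design on $K$ has at least $c\,t^{2n}$ points. -/

import Mathlib

open MeasureTheory Set
open scoped ENNReal

noncomputable section

/-- A convex `n`-polytope in `ℝⁿ`: a bounded intersection of finitely many closed half-spaces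
`{x | ⟪a, x⟫ ≤ b}`, with non-empty interior (so of full dimension `n`). -/
def IsConvexPolytope {n : ℕ} (K : Set (EuclideanSpace ℝ (Fin n))) : Prop :=
  Bornology.IsBounded K ∧ (interior K).Nonempty ∧
    ∃ H : Finset (EuclideanSpace ℝ (Fin n) × ℝ), K = {x | ∀ h ∈ H, inner ℝ h.1 x ≤ h.2}

/-- `Φ` is a facet of `K ⊆ ℝⁿ`: a non-empty exposed face of dimension `n - 1`. -/
def IsFacet {n : ℕ} (K Φ : Set (EuclideanSpace ℝ (Fin n))) : Prop :=
  Φ.Nonempty ∧ IsExposed ℝ K Φ ∧ Module.finrank ℝ (vectorSpan ℝ Φ) + 1 = n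

/-- `K ⊆ ℝⁿ` is simple: each of its vertices lies on exactly `n` facets. -/
def IsSimple {n : ℕ} (K : Set (EuclideanSpace ℝ (Fin n))) : Prop :=
  ∀ v ∈ K.extremePoints ℝ, {Φ | IsFacet K Φ ∧ v ∈ Φ}.encard = n

/-- The coordinate `x_Φ` of a facet `Φ`: the distance of `x` to the hyperplane spanned by `Φ`. -/
def facetDist {n : ℕ} (Φ : Set (EuclideanSpace ℝ (Fin n))) (x : EuclideanSpace ℝ (Fin n)) : ℝ :=
  Metric.infDist x (affineSpan ℝ Φ : Set (EuclideanSpace ℝ (Fin n)))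

/-- The quadratic form `ds² = ∑_Φ dx_Φ² / x_Φ` (sum over the facets `Φ` of `K`) at the point
`x ∈ K`, evaluated at the tangent vector `v`. On `K` each `x_Φ` is the restriction of an affine
function. The values lie in `[0, ∞]`, with `0 / 0 = 0` and `a / 0 = ∞` for `a ≠ 0`. -/
def facetMetric {n : ℕ} (K : Set (EuclideanSpace ℝ (Fin n))) (x v : EuclideanSpace ℝ (Fin n)) :
    ℝ≥0∞ :=
  ∑' Φ : {Φ : Set (EuclideanSpace ℝ (Fin n)) // IsFacet K Φ},
    ‖fderivWithin ℝ (facetDist Φ.1) K x v‖ₑ ^ 2 / ENNReal.ofReal (facetDist Φ.1 x)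

/-- The length `∫ ds` of a curve `γ : [0, 1] → K`. -/
def facetLength {n : ℕ} (K : Set (EuclideanSpace ℝ (Fin n))) (γ : ℝ → EuclideanSpace ℝ (Fin n)) :
    ℝ≥0∞ :=
  ∫⁻ s in Icc (0 : ℝ) 1, facetMetric K (γ s) (derivWithin γ (Icc 0 1) s) ^ (1 / 2 : ℝ)

/-- The distance on `K` defined by `ds²`: the infimum of the lengths of the `C¹` curves in `K`
from `x` to `y`. -/
def facetEDist {n : ℕ} (K : Set (EuclideanSpace ℝ (Fin n))) (x y : EuclideanSpace ℝ (Fin n)) :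
    ℝ≥0∞ :=
  ⨅ (γ : ℝ → EuclideanSpace ℝ (Fin n)) (_ : ContDiffOn ℝ 1 γ (Icc 0 1))
    (_ : MapsTo γ (Icc 0 1) K) (_ : γ 0 = x) (_ : γ 1 = y), facetLength K γ

/-- A finite set of points of `ℝⁿ` with real weights. (Only the weights of the points of the set
matter.) -/
structure WeightedPoints (n : ℕ) where
  points : Finset (EuclideanSpace ℝ (Fin n))
  weight : EuclideanSpace ℝ (Fin n) → ℝ

namespace WeightedPoints

variable {n : ℕ}

/-- `F` is a `t`-cubature formula for `μ`: `∫ P dμ = ∑ w_a P(p_a)` for all polynomials `P` of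
degree at most `t`. -/
def IsCubature (F : WeightedPoints n) (μ : Measure (EuclideanSpace ℝ (Fin n))) (t : ℕ) : Prop :=
  ∀ P : MvPolynomial (Fin n) ℝ, P.totalDegree ≤ t →
    ∫ x, MvPolynomial.eval (fun i => x i) P ∂μ =
      ∑ p ∈ F.points, F.weight p * MvPolynomial.eval (fun i => p i) P

/-- All weights are positive. -/
def IsPositive (F : WeightedPoints n) : Prop := ∀ p ∈ F.points, 0 < F.weight p

/-- All weights are equal. -/
def IsEqualWeight (F : WeightedPoints n) : Prop :=
  ∀ p ∈ F.points, ∀ q ∈ F.points, F.weight p = F.weight q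

/-- All points lie in the interior of the support of `μ`. -/
def IsInterior (F : WeightedPoints n) (μ : Measure (EuclideanSpace ℝ (Fin n))) : Prop :=
  ∀ p ∈ F.points, p ∈ interior μ.support

/-- All points lie in the support of `μ`, and some point lies on its boundary. -/
def IsBoundary (F : WeightedPoints n) (μ : Measure (EuclideanSpace ℝ (Fin n))) : Prop :=
  (∀ p ∈ F.points, p ∈ μ.support) ∧ ∃ p ∈ F.points, p ∈ frontier μ.support

/-- A `t`-design: a `t`-cubature formula with equal weights that is interior or boundary. -/
def IsDesign (F : WeightedPoints n) (μ : Measure (EuclideanSpace ℝ (Fin n))) (t : ℕ) : Prop :=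
  F.IsCubature μ t ∧ F.IsEqualWeight ∧ (F.IsInterior μ ∨ F.IsBoundary μ)

/-- The points of `F` form an `ε`-net of `K` for the distance `facetEDist K`: every point of `K`
is at distance at most `ε` from a point of `F`. -/
def IsFacetNet (F : WeightedPoints n) (K : Set (EuclideanSpace ℝ (Fin n))) (ε : ℝ) : Prop :=
  ∀ x ∈ K, ∃ p ∈ F.points, facetEDist K x p ≤ ENNReal.ofReal ε

end WeightedPoints

/-- The uniform probability measure on `K`, i.e. normalized Lebesgue measure. -/
def uniformMeasure {n : ℕ} (K : Set (EuclideanSpace ℝ (Fin n))) :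
    Measure (EuclideanSpace ℝ (Fin n)) :=
  ProbabilityTheory.cond volume K

end

/-! ### The Fejér kernel in algebraic form -/

/-! Near each `y ∈ K` one builds a nonnegative polynomial of degree `O(t)` concentrated on the scale
dictated by the metric, and tests the cubature formula on it. In one variable the substitution `x =
cos θ` turns the Fejér kernel into a polynomial centred at `y ∈ [-1, 1]`, of width `√(1 - y²)/M +
1/M²` (`eval_fejerPoly_mul_le`, `le_eval_fejerPoly`). Composing with affine functions `f k`, raising
to an even power and multiplying gives `productKernel`. Its decay is measured by a function `g`
homogeneous about `y`. By convexity the sublevel sets of `g` in `K` grow no faster than the `n`-th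
power of the level, so a fast enough decay bounds the second moment of `g` by a constant times the
mass (`productKernel_concentration`).

With `q` the kernel and `D ≤ g²` a sum of squares, the polynomial `(A + 1 - D) q` therefore has
positive integral. A positive formula must have a node with `D ≤ A + 1`, that is, a node near `y`
(`exists_point_near`).

For the net, the affine functions are `1 - x_Φ / L`. Their width near `x_Φ = 0` is of order `√x_Φ /
M + 1/M²`, so `√x_Φ` changes by `O(1/M)`, and `2√x_Φ` is arc length for `dx_Φ² / x_Φ`; a straight
segment then suffices (`facetEDist_le`).

For the weights, `y` is a vertex `v` and one affine function peaks there. The width at the endpoint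
`1` is `1/M²`, so the kernel has mass of order `M^(-2n)`, while some node near `v` sees a kernel
value bounded below; its weight is thus `O(t^(-2n))`. For designs all weights are the inverse of the
number of points. -/

theorem one_sub_cos_mul_dirichlet (i : ℕ) (z : ℝ) :
    (1 - Real.cos z) * (1 + 2 * ∑ j ∈ Finset.range i, Real.cos ((j + 1 : ℕ) * z)) =
      Real.cos (i * z) - Real.cos ((i + 1 : ℕ) * z) := by
  induction i with
  | zero => simp
  | succ i ih =>
    rw [Finset.sum_range_succ, mul_add 2, ← add_assoc, mul_add, ih]
    have h1 : ((i + 1 + 1 : ℕ) : ℝ) * z = (i + 1 : ℕ) * z + z := by push_cast; ring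
    have h2 : (i : ℝ) * z = (i + 1 : ℕ) * z - z := by push_cast; ring
    rw [h1, h2, Real.cos_add, Real.cos_sub]
    ring

/-- The cosine sum `∑_{|j| < M} (M - |j|) cos (j z)`. -/
noncomputable def fejerSum (M : ℕ) (z : ℝ) : ℝ :=
  ∑ i ∈ Finset.range M, (1 + 2 * ∑ j ∈ Finset.range i, Real.cos ((j + 1 : ℕ) * z))

/-- The Dirichlet identities telescope. The identity yields both positivity and decay of the kernel.
-/
theorem one_sub_cos_mul_fejerSum (M : ℕ) (z : ℝ) :
    (1 - Real.cos z) * fejerSum M z = 1 - Real.cos (M * z) := by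
  unfold fejerSum
  rw [Finset.mul_sum, Finset.sum_congr rfl fun i _ => one_sub_cos_mul_dirichlet i z,
    Finset.sum_range_sub' (fun i : ℕ => Real.cos (i * z))]
  simp

theorem sum_range_one_add_two_mul (M : ℕ) :
    ∑ i ∈ Finset.range M, (1 + 2 * (i : ℝ)) = (M : ℝ) ^ 2 := by
  induction M with
  | zero => simp
  | succ M ih => rw [Finset.sum_range_succ, ih]; push_cast; ring

theorem fejerSum_le (M : ℕ) (z : ℝ) : fejerSum M z ≤ (M : ℝ) ^ 2 := by
  rw [← sum_range_one_add_two_mul]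
  refine Finset.sum_le_sum fun i _ => ?_
  have : ∑ j ∈ Finset.range i, Real.cos ((j + 1 : ℕ) * z) ≤ ∑ j ∈ Finset.range i, (1 : ℝ) :=
    Finset.sum_le_sum fun j _ => Real.cos_le_one _
  simp only [Finset.sum_const, Finset.card_range, nsmul_eq_mul, mul_one] at this
  linarith

theorem le_fejerSum {M : ℕ} {z : ℝ} (hz : M * |z| ≤ 1) : (M : ℝ) ^ 2 / 2 ≤ fejerSum M z := by
  rw [← sum_range_one_add_two_mul, Finset.sum_div]
  refine Finset.sum_le_sum fun i hi => ?_
  have : ∑ j ∈ Finset.range i, (1 / 2 : ℝ) ≤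
      ∑ j ∈ Finset.range i, Real.cos ((j + 1 : ℕ) * z) := by
    refine Finset.sum_le_sum fun j hj => ?_
    have hjM : ((j + 1 : ℕ) : ℝ) ≤ M := by
      rw [Finset.mem_range] at hi hj
      exact_mod_cast (by omega : j + 1 ≤ M)
    have h1 : |((j + 1 : ℕ) : ℝ) * z| ≤ 1 := by
      rw [abs_mul, Nat.abs_cast]
      exact (mul_le_mul_of_nonneg_right hjM (abs_nonneg z)).trans hz
    have h2 := Real.one_sub_sq_div_two_le_cos (x := ((j + 1 : ℕ) : ℝ) * z)
    have h3 := (sq_le_one_iff_abs_le_one _).2 h1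
    linarith
  simp only [Finset.sum_const, Finset.card_range, nsmul_eq_mul] at this
  linarith

theorem fejerSum_nonneg (M : ℕ) (z : ℝ) : 0 ≤ fejerSum M z := by
  rcases (sub_nonneg.2 (Real.cos_le_one z)).eq_or_lt with h | h
  -- At multiples of `2π` the product identity says nothing, but there every cosine in the sum
  -- equals `1`.
  · have h1 : Real.cos z = 1 := by linarith
    obtain ⟨k, hk⟩ := (Real.cos_eq_one_iff z).1 h1
    refine Finset.sum_nonneg fun i _ => ?_
    have : 0 ≤ ∑ j ∈ Finset.range i, Real.cos ((j + 1 : ℕ) * z) := by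
      refine Finset.sum_nonneg fun j _ => ?_
      have : ((j + 1 : ℕ) : ℝ) * z = ((((j + 1 : ℕ) : ℤ) * k : ℤ) : ℝ) * (2 * Real.pi) := by
        rw [← hk]; push_cast; ring
      rw [this, Real.cos_int_mul_two_pi]
      exact zero_le_one
    linarith
  · have := one_sub_cos_mul_fejerSum M z
    exact nonneg_of_mul_nonneg_right (this ▸ sub_nonneg.2 (Real.cos_le_one _)) h

/-- The algebraic Fejér kernel centred at `y`, as a polynomial in the other variable. -/
noncomputable def fejerPoly (M : ℕ) (y : ℝ) : Polynomial ℝ :=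
  Polynomial.C (1 / (M : ℝ) ^ 2) * ∑ i ∈ Finset.range M, (1 + 2 * ∑ j ∈ Finset.range i,
    Polynomial.C ((Polynomial.Chebyshev.T ℝ ((j + 1 : ℕ) : ℤ)).eval y) *
      Polynomial.Chebyshev.T ℝ ((j + 1 : ℕ) : ℤ))

theorem natDegree_fejerPoly_le (M : ℕ) (y : ℝ) : (fejerPoly M y).natDegree ≤ M := by
  refine (Polynomial.natDegree_C_mul_le _ _).trans
    (Polynomial.natDegree_sum_le_of_forall_le _ _ fun i hi => ?_)
  rw [Finset.mem_range] at hi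
  refine (Polynomial.natDegree_add_le _ _).trans (max_le (by simp) ?_)
  refine (Polynomial.natDegree_mul_le).trans ?_
  have h2 : (2 : Polynomial ℝ).natDegree = 0 := Polynomial.natDegree_ofNat 2
  rw [h2, zero_add]
  refine Polynomial.natDegree_sum_le_of_forall_le _ _ fun j hj => ?_
  rw [Finset.mem_range] at hj
  refine (Polynomial.natDegree_C_mul_le _ _).trans ?_
  rw [Polynomial.Chebyshev.natDegree_T]
  simp only [Int.natAbs_natCast]
  omega

theorem eval_fejerPoly (M : ℕ) (x y : ℝ) :
    (fejerPoly M y).eval x = 1 / (M : ℝ) ^ 2 * ∑ i ∈ Finset.range M,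
      (1 + 2 * ∑ j ∈ Finset.range i, (Polynomial.Chebyshev.T ℝ ((j + 1 : ℕ) : ℤ)).eval y *
        (Polynomial.Chebyshev.T ℝ ((j + 1 : ℕ) : ℤ)).eval x) := by
  simp [fejerPoly, Polynomial.eval_finsetSum]

theorem eval_fejerPoly_cos (M : ℕ) (θ φ : ℝ) :
    (fejerPoly M (Real.cos φ)).eval (Real.cos θ) =
      (fejerSum M (θ - φ) + fejerSum M (θ + φ)) / (2 * (M : ℝ) ^ 2) := by
  have key : fejerSum M (θ - φ) + fejerSum M (θ + φ) = 2 * ∑ i ∈ Finset.range M,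
      (1 + 2 * ∑ j ∈ Finset.range i, Real.cos ((j + 1 : ℕ) * φ) * Real.cos ((j + 1 : ℕ) * θ)) := by
    unfold fejerSum
    rw [← Finset.sum_add_distrib, Finset.mul_sum]
    refine Finset.sum_congr rfl fun i _ => ?_
    have : ∑ j ∈ Finset.range i, Real.cos ((j + 1 : ℕ) * (θ - φ)) +
        ∑ j ∈ Finset.range i, Real.cos ((j + 1 : ℕ) * (θ + φ)) =
        2 * ∑ j ∈ Finset.range i, Real.cos ((j + 1 : ℕ) * φ) * Real.cos ((j + 1 : ℕ) * θ) := by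
      rw [← Finset.sum_add_distrib, Finset.mul_sum]
      refine Finset.sum_congr rfl fun j _ => ?_
      rw [mul_sub, mul_add, Real.cos_sub, Real.cos_add]
      ring
    linarith
  rw [eval_fejerPoly, key]
  simp only [Polynomial.Chebyshev.T_real_cos, Int.cast_natCast]
  rw [mul_div_mul_left _ _ two_ne_zero, one_div_mul_eq_div]

/-- Needed for nodes outside `K`, at which the affine function peaking at a vertex may exceed `1`.
-/
theorem one_le_eval_fejerPoly_one {M : ℕ} (hM : 1 ≤ M) {x : ℝ} (hx : 1 ≤ x) :
    1 ≤ (fejerPoly M 1).eval x := by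
  have hM0 : (0 : ℝ) < M := by exact_mod_cast hM
  rw [eval_fejerPoly, one_div, inv_mul_eq_div, le_div_iff₀ (by positivity), one_mul,
    ← sum_range_one_add_two_mul]
  refine Finset.sum_le_sum fun i _ => ?_
  have : ∑ j ∈ Finset.range i, (1 : ℝ) ≤ ∑ j ∈ Finset.range i,
      (Polynomial.Chebyshev.T ℝ ((j + 1 : ℕ) : ℤ)).eval 1 *
        (Polynomial.Chebyshev.T ℝ ((j + 1 : ℕ) : ℤ)).eval x := by
    refine Finset.sum_le_sum fun j _ => ?_
    rw [Polynomial.Chebyshev.T_eval_one, one_mul]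
    exact Polynomial.Chebyshev.one_le_eval_T_real _ hx
  simp only [Finset.sum_const, Finset.card_range, nsmul_eq_mul, mul_one] at this
  linarith

/-- The width of the Fejér kernel of order `M` at `y ∈ [-1, 1]`. -/
noncomputable def fejerWidth (M : ℕ) (y : ℝ) : ℝ := √(1 - y ^ 2) / M + 1 / (M : ℝ) ^ 2

theorem fejerWidth_pos {M : ℕ} (hM : 1 ≤ M) (y : ℝ) : 0 < fejerWidth M y := by
  have hM0 : (0 : ℝ) < M := by exact_mod_cast hM
  unfold fejerWidth
  positivity

theorem fejerWidth_cos (M : ℕ) {φ : ℝ} (h0 : 0 ≤ φ) (hφ : φ ≤ Real.pi) :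
    fejerWidth M (Real.cos φ) = Real.sin φ / M + 1 / (M : ℝ) ^ 2 := by
  rw [fejerWidth, ← Real.abs_sin_eq_sqrt_one_sub_cos_sq,
    abs_of_nonneg (Real.sin_nonneg_of_nonneg_of_le_pi h0 hφ)]

theorem eval_fejerPoly_nonneg (M : ℕ) {x y : ℝ} (hx : x ∈ Icc (-1 : ℝ) 1)
    (hy : y ∈ Icc (-1 : ℝ) 1) : 0 ≤ (fejerPoly M y).eval x := by
  rw [← Real.cos_arccos hx.1 hx.2, ← Real.cos_arccos hy.1 hy.2, eval_fejerPoly_cos]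
  have := fejerSum_nonneg M (Real.arccos x - Real.arccos y)
  have := fejerSum_nonneg M (Real.arccos x + Real.arccos y)
  positivity

/-- Expand `cos (φ + (θ - φ))`. The bound involves `θ` only through `1 - cos (θ - φ)`, the factor in
the Fejér identity. -/
theorem abs_cos_sub_cos_le {θ φ : ℝ} (h0 : 0 ≤ φ) (hφ : φ ≤ Real.pi) :
    |Real.cos θ - Real.cos φ| ≤ (1 - Real.cos (θ - φ)) +
      Real.sin φ * √(2 * (1 - Real.cos (θ - φ))) := by
  have hs := Real.sin_nonneg_of_nonneg_of_le_pi h0 hφ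
  have h1 : Real.cos θ - Real.cos φ =
      -(Real.cos φ * (1 - Real.cos (θ - φ))) - Real.sin φ * Real.sin (θ - φ) := by
    have : θ = φ + (θ - φ) := by ring
    conv_lhs => rw [this, Real.cos_add]
    ring
  have hc := sub_nonneg.2 (Real.cos_le_one (θ - φ))
  have h2 : |Real.sin (θ - φ)| ≤ √(2 * (1 - Real.cos (θ - φ))) := by
    refine Real.abs_le_sqrt ?_
    have := Real.sin_sq_add_cos_sq (θ - φ)
    nlinarith [sq_nonneg (1 - Real.cos (θ - φ))]
  rw [h1]
  refine (abs_sub _ _).trans (add_le_add ?_ ?_)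
  · rw [abs_neg, abs_mul, abs_of_nonneg hc]
    exact mul_le_of_le_one_left hc (Real.abs_cos_le_one φ)
  · rw [abs_mul, abs_of_nonneg hs]
    exact mul_le_mul_of_nonneg_left h2 hs

/-- With `e = M √(1 - cos (θ - φ))`, the normalized distance factor is at most `(1 + e)² ≤ 2 + 2e²`,
while the kernel `k` satisfies `k ≤ 1` and `k e² ≤ 2`. -/
theorem eval_fejerPoly_mul_le {M : ℕ} (hM : 1 ≤ M) {x y : ℝ} (hx : x ∈ Icc (-1 : ℝ) 1)
    (hy : y ∈ Icc (-1 : ℝ) 1) :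
    (fejerPoly M y).eval x * (1 + |x - y| / fejerWidth M y) ≤ 8 := by
  have hM0 : (0 : ℝ) < M := by exact_mod_cast hM
  have hnn := eval_fejerPoly_nonneg M hx hy
  obtain ⟨θ, hθ, rfl⟩ : ∃ θ ∈ Icc 0 Real.pi, Real.cos θ = x :=
    ⟨_, ⟨Real.arccos_nonneg x, Real.arccos_le_pi x⟩, Real.cos_arccos hx.1 hx.2⟩
  obtain ⟨φ, hφ, rfl⟩ : ∃ φ ∈ Icc 0 Real.pi, Real.cos φ = y :=
    ⟨_, ⟨Real.arccos_nonneg y, Real.arccos_le_pi y⟩, Real.cos_arccos hy.1 hy.2⟩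
  have hsθ := Real.sin_nonneg_of_nonneg_of_le_pi hθ.1 hθ.2
  have hsφ := Real.sin_nonneg_of_nonneg_of_le_pi hφ.1 hφ.2
  set c := 1 - Real.cos (θ - φ) with hc
  have hc0 : 0 ≤ c := sub_nonneg.2 (Real.cos_le_one _)
  set e := M * √c with he
  have he0 : 0 ≤ e := by positivity
  have he2 : e ^ 2 = M ^ 2 * c := by rw [he, mul_pow, Real.sq_sqrt hc0]
  have hδ := fejerWidth_pos hM (Real.cos φ)
  have hg : 1 + |Real.cos θ - Real.cos φ| / fejerWidth M (Real.cos φ) ≤ (1 + e) ^ 2 := by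
    have h1 : |Real.cos θ - Real.cos φ| ≤ ((1 + e) ^ 2 - 1) * fejerWidth M (Real.cos φ) := by
      refine (abs_cos_sub_cos_le hφ.1 hφ.2).trans ?_
      rw [← hc, fejerWidth_cos M hφ.1 hφ.2, Real.sqrt_mul (by norm_num)]
      have h2 : √2 ≤ 2 := by
        rw [Real.sqrt_le_left (by norm_num)]; norm_num
      have h3 : c = e ^ 2 * (1 / (M : ℝ) ^ 2) := by rw [he2]; field_simp
      have h4 : √c = e * (1 / M) := by rw [he]; field_simp
      have h5 : Real.sin φ * (√2 * √c) ≤ 2 * e * (Real.sin φ / M) := by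
        rw [h4]
        have : 0 ≤ Real.sin φ * (e * (1 / M)) := by positivity
        calc Real.sin φ * (√2 * (e * (1 / M))) = √2 * (Real.sin φ * (e * (1 / M))) := by ring
          _ ≤ 2 * (Real.sin φ * (e * (1 / M))) := mul_le_mul_of_nonneg_right h2 this
          _ = _ := by ring
      have h6 : 0 ≤ Real.sin φ / M := by positivity
      have h7 : 0 ≤ 1 / (M : ℝ) ^ 2 := by positivity
      have h8 := mul_nonneg (sq_nonneg e) h6
      have h9 := mul_nonneg he0 h7
      nlinarith
    have := (div_le_iff₀ hδ).2 h1
    linarith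
  have hk1 : (fejerPoly M (Real.cos φ)).eval (Real.cos θ) ≤ 1 := by
    rw [eval_fejerPoly_cos, div_le_one (by positivity)]
    have := fejerSum_le M (θ - φ)
    have := fejerSum_le M (θ + φ)
    linarith
  have hk2 : (fejerPoly M (Real.cos φ)).eval (Real.cos θ) * e ^ 2 ≤ 2 := by
    rw [eval_fejerPoly_cos, he2]
    have h1 : c * fejerSum M (θ - φ) ≤ 2 := by
      rw [hc, one_sub_cos_mul_fejerSum]
      linarith [Real.neg_one_le_cos (M * (θ - φ))]
    -- The reflected angle is no closer to `0` modulo `2π`: `cos (θ - φ) - cos (θ + φ) = 2 sin θ sin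
    -- φ ≥ 0`.
    have h2 : c * fejerSum M (θ + φ) ≤ 2 := by
      refine le_trans (mul_le_mul_of_nonneg_right (?_ : c ≤ 1 - Real.cos (θ + φ))
        (fejerSum_nonneg M _)) ?_
      · rw [hc, Real.cos_sub, Real.cos_add]
        nlinarith [mul_nonneg hsθ hsφ]
      · rw [one_sub_cos_mul_fejerSum]
        linarith [Real.neg_one_le_cos (M * (θ + φ))]
    have : (fejerSum M (θ - φ) + fejerSum M (θ + φ)) / (2 * (M : ℝ) ^ 2) * (M ^ 2 * c) =
        (c * fejerSum M (θ - φ) + c * fejerSum M (θ + φ)) / 2 := by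
      field_simp
    rw [this]
    linarith
  refine (mul_le_mul_of_nonneg_left hg hnn).trans ?_
  set k := (fejerPoly M (Real.cos φ)).eval (Real.cos θ)
  nlinarith [mul_nonneg hnn (sq_nonneg (1 - e))]

/-- Closeness of `x` and `y` on the scale of the width forces `M |θ - φ| ≤ 1`, where the Fejér sum
is at least `M² / 2`. The angle is recovered from `|x - y| = 2 S s`, with `S`, `s` the sines of the
half sum and of the absolute half difference, using `s ≤ S` and `sin φ ≤ 2 S`. -/
theorem le_eval_fejerPoly {M : ℕ} (hM : 1 ≤ M) {x y : ℝ} (hx : x ∈ Icc (-1 : ℝ) 1)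
    (hy : y ∈ Icc (-1 : ℝ) 1) (hxy : |x - y| / fejerWidth M y ≤ 1 / 16) :
    1 / 4 ≤ (fejerPoly M y).eval x := by
  have hM0 : (0 : ℝ) < M := by exact_mod_cast hM
  rw [div_le_iff₀ (fejerWidth_pos hM y)] at hxy
  obtain ⟨θ, hθ, rfl⟩ : ∃ θ ∈ Icc 0 Real.pi, Real.cos θ = x :=
    ⟨_, ⟨Real.arccos_nonneg x, Real.arccos_le_pi x⟩, Real.cos_arccos hx.1 hx.2⟩
  obtain ⟨φ, hφ, rfl⟩ : ∃ φ ∈ Icc 0 Real.pi, Real.cos φ = y :=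
    ⟨_, ⟨Real.arccos_nonneg y, Real.arccos_le_pi y⟩, Real.cos_arccos hy.1 hy.2⟩
  have hsφ := Real.sin_nonneg_of_nonneg_of_le_pi hφ.1 hφ.2
  have hsθ := Real.sin_nonneg_of_nonneg_of_le_pi hθ.1 hθ.2
  rw [fejerWidth_cos M hφ.1 hφ.2] at hxy
  have hpi := Real.pi_pos
  set a := |(θ - φ) / 2| with ha
  have ha0 : 0 ≤ a := abs_nonneg _
  have ha2 : a ≤ Real.pi / 2 := by
    rw [ha, abs_le]; constructor <;> linarith [hθ.1, hθ.2, hφ.1, hφ.2]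
  have hsa : Real.sin a = |Real.sin ((θ - φ) / 2)| := by
    rw [ha]
    exact (Real.abs_sin_eq_sin_abs_of_abs_le_pi (by linarith [ha2])).symm
  set s := Real.sin a with hs
  set S := Real.sin ((θ + φ) / 2) with hS
  have hS0 : 0 ≤ S := Real.sin_nonneg_of_nonneg_of_le_pi (by linarith [hθ.1, hφ.1])
    (by linarith [hθ.2, hφ.2])
  have hs0 : 0 ≤ s := hsa ▸ abs_nonneg _
  have hC : |Real.cos θ - Real.cos φ| = 2 * S * s := by
    rw [Real.cos_sub_cos, abs_mul, abs_mul, ← hsa, abs_of_nonneg hS0]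
    norm_num
  have hsS : s ≤ S := by
    have h2 : s ^ 2 ≤ S ^ 2 := by
      rw [hsa, sq_abs, hS, Real.sin_sq_eq_half_sub, Real.sin_sq_eq_half_sub]
      rw [show 2 * ((θ - φ) / 2) = θ - φ by ring, show 2 * ((θ + φ) / 2) = θ + φ by ring,
        Real.cos_sub, Real.cos_add]
      nlinarith [mul_nonneg hsθ hsφ]
    exact (pow_le_pow_iff_left₀ hs0 hS0 two_ne_zero).1 h2
  have hφS : Real.sin φ ≤ 2 * S := by
    have : φ = (θ + φ) / 2 - (θ - φ) / 2 := by ring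
    have h1 : Real.sin φ = S * Real.cos ((θ - φ) / 2) -
        Real.cos ((θ + φ) / 2) * Real.sin ((θ - φ) / 2) := by
      conv_lhs => rw [this, Real.sin_sub]
    have h2 : S * Real.cos ((θ - φ) / 2) ≤ S :=
      mul_le_of_le_one_right hS0 (Real.cos_le_one _)
    have h3 : -(Real.cos ((θ + φ) / 2) * Real.sin ((θ - φ) / 2)) ≤ s := by
      refine (neg_le_abs _).trans ?_
      rw [abs_mul, ← hsa]
      exact mul_le_of_le_one_left hs0 (Real.abs_cos_le_one _)
    linarith
  have hsM : M * s ≤ 1 / 4 := by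
    rw [hC] at hxy
    have hxy' : 16 * (2 * (M * S) * (M * s)) ≤ M * Real.sin φ + 1 := by
      have := mul_le_mul_of_nonneg_left hxy (by positivity : (0 : ℝ) ≤ 16 * M ^ 2)
      have e1 : 16 * (M : ℝ) ^ 2 * (1 / 16 * (Real.sin φ / M + 1 / (M : ℝ) ^ 2)) =
        M * Real.sin φ + 1 := by field_simp
      rw [e1] at this
      linarith
    by_contra! h
    -- If `M s > 1/4` then also `M S > 1/4`, which contradicts `32 (M S)(M s) ≤ 2 M S + 1`.
    have h1 : (M : ℝ) * s ≤ M * S := by gcongr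
    have h2 : (M : ℝ) * Real.sin φ ≤ 2 * (M * S) := by
      linarith [mul_le_mul_of_nonneg_left hφS hM0.le]
    nlinarith
  have hz : M * |θ - φ| ≤ 1 := by
    have h1 := Real.mul_le_sin ha0 ha2
    have h2 : |θ - φ| = 2 * a := by
      rw [ha, abs_div, abs_of_pos (by norm_num : (0 : ℝ) < 2)]; ring
    have h3 : a ≤ Real.pi / 2 * s := by
      have := mul_le_mul_of_nonneg_left h1 (by positivity : 0 ≤ Real.pi / 2)
      have e1 : Real.pi / 2 * (2 / Real.pi * a) = a := by field_simp
      linarith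
    rw [h2]
    have h4 : (M : ℝ) * a ≤ Real.pi / 2 * (M * s) := by
      linarith [mul_le_mul_of_nonneg_left h3 hM0.le]
    nlinarith [Real.pi_le_four]
  rw [eval_fejerPoly_cos, le_div_iff₀ (by positivity)]
  linarith [le_fejerSum hz, fejerSum_nonneg M (θ + φ)]

/-! ### Concentration on convex bodies -/

/-- Sublevel sets in a convex set of a function that is homogeneous about one of its points grow
at most like the dimension allows. -/
theorem volume_sublevel_le {n : ℕ} {K : Set (EuclideanSpace ℝ (Fin n))} (hK : Convex ℝ K)
    {y : EuclideanSpace ℝ (Fin n)} (hy : y ∈ K) {g : EuclideanSpace ℝ (Fin n) → ℝ}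
    (hg : ∀ x, ∀ r ∈ Icc (0 : ℝ) 1, g (y + r • (x - y)) = r * g x) {a b : ℝ} (ha : 0 < a)
    (hab : a ≤ b) :
    volume (K ∩ {x | g x ≤ b}) ≤ ENNReal.ofReal ((b / a) ^ n) * volume (K ∩ {x | g x ≤ a}) := by
  have hb : 0 < b := ha.trans_le hab
  have hr : a / b ∈ Icc (0 : ℝ) 1 := ⟨by positivity, (div_le_one hb).2 hab⟩
  -- Shrinking towards `y` by `a / b` stays in `K` by convexity and multiplies volume by `(a /
  -- b)^n`.
  have hsub : AffineMap.homothety y (a / b) '' (K ∩ {x | g x ≤ b}) ⊆ K ∩ {x | g x ≤ a} := by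
    rintro _ ⟨x, ⟨hxK, hx⟩, rfl⟩
    have e : AffineMap.homothety y (a / b) x = y + (a / b) • (x - y) := by
      rw [AffineMap.homothety_apply, vsub_eq_sub, vadd_eq_add, add_comm]
    rw [e]
    refine ⟨hK.add_smul_sub_mem hy hxK hr, ?_⟩
    rw [mem_ofPred_eq, hg x _ hr]
    calc a / b * g x ≤ a / b * b := mul_le_mul_of_nonneg_left hx hr.1
      _ = a := by field_simp
  have h := measure_mono (μ := volume) hsub
  rw [Measure.addHaar_image_homothety, finrank_euclideanSpace_fin, abs_of_nonneg
    (pow_nonneg hr.1 n)] at h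
  calc volume (K ∩ {x | g x ≤ b}) = ENNReal.ofReal ((b / a) ^ n) *
        (ENNReal.ofReal ((a / b) ^ n) * volume (K ∩ {x | g x ≤ b})) := by
        rw [← mul_assoc, ← ENNReal.ofReal_mul (by positivity), ← mul_pow,
          div_mul_div_cancel₀ ha.ne', div_self hb.ne', one_pow, ENNReal.ofReal_one, one_mul]
    _ ≤ _ := by gcongr

theorem summable_one_div_succ_sq : Summable fun j : ℕ => 1 / ((j : ℝ) + 1) ^ 2 := by
  have := (summable_nat_add_iff 1).2 (Real.summable_one_div_nat_pow.2 (by norm_num : 1 < 2))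
  simpa using this

/-- Slice by the integer part `j` of `g`: volume growth costs `(j + 1)^n`, and the exponent `n + 2`
leaves the summable `1 / (j + 1)²`. -/
theorem lintegral_one_add_pow_inv_le {n : ℕ} {K : Set (EuclideanSpace ℝ (Fin n))}
    (hK : Convex ℝ K)
    {y : EuclideanSpace ℝ (Fin n)} (hy : y ∈ K) {g : EuclideanSpace ℝ (Fin n) → ℝ}
    (hgc : Continuous g) (hg0 : ∀ x, 0 ≤ g x)
    (hg : ∀ x, ∀ r ∈ Icc (0 : ℝ) 1, g (y + r • (x - y)) = r * g x) {a : ℝ} (ha : 0 < a)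
    (ha1 : a ≤ 1) :
    ∫⁻ x in K, ENNReal.ofReal (1 / (1 + g x) ^ (n + 2)) ≤
      ENNReal.ofReal ((1 / a) ^ n * ∑' j : ℕ, 1 / ((j : ℝ) + 1) ^ 2) *
        volume (K ∩ {x | g x ≤ a}) := by
  have hS : ∀ b : ℝ, MeasurableSet {x | g x ≤ b} := fun b =>
    (isClosed_le hgc continuous_const).measurableSet
  calc ∫⁻ x in K, ENNReal.ofReal (1 / (1 + g x) ^ (n + 2))
      ≤ ∫⁻ x in K, ∑' j : ℕ, {x | g x ≤ (j : ℝ) + 1}.indicator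
          (fun _ => ENNReal.ofReal (1 / ((j : ℝ) + 1) ^ (n + 2))) x := by
        refine lintegral_mono fun x => ?_
        refine le_trans ?_ (ENNReal.le_tsum ⌊g x⌋₊)
        rw [indicator_of_mem (by exact (Nat.lt_floor_add_one (g x)).le)]
        refine ENNReal.ofReal_le_ofReal ?_
        have := Nat.floor_le (hg0 x)
        gcongr 1 / ?_ ^ _
        linarith
    _ = ∑' j : ℕ, ENNReal.ofReal (1 / ((j : ℝ) + 1) ^ (n + 2)) *
          volume (K ∩ {x | g x ≤ (j : ℝ) + 1}) := by
        rw [lintegral_tsum fun j => (measurable_const.indicator (hS _)).aemeasurable]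
        refine tsum_congr fun j => ?_
        rw [lintegral_indicator_const (hS _), Measure.restrict_apply (hS _), inter_comm]
    _ ≤ ∑' j : ℕ, ENNReal.ofReal ((1 / a) ^ n * (1 / ((j : ℝ) + 1) ^ 2)) *
          volume (K ∩ {x | g x ≤ a}) := by
        refine ENNReal.tsum_le_tsum fun j => ?_
        have hj : (0 : ℝ) ≤ j := Nat.cast_nonneg j
        refine (mul_le_mul_right (volume_sublevel_le hK hy hg ha (by linarith)) _).trans ?_
        rw [← mul_assoc, ← ENNReal.ofReal_mul (by positivity)]
        refine le_of_eq ?_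
        congr 2
        rw [div_pow, div_pow, one_pow, pow_add]
        field_simp
    _ = _ := by
        rw [ENNReal.tsum_mul_right, ← tsum_mul_left, ENNReal.ofReal_tsum_of_nonneg]
        · intro j; positivity
        · exact summable_one_div_succ_sq.mul_left _

/-- The constant in the comparison of the mass of a bump with the volume of its core. -/
noncomputable def bumpConst (n : ℕ) : ℝ := (1 / (1 / 16 : ℝ)) ^ n * ∑' j : ℕ, 1 / ((j : ℝ) + 1) ^ 2

theorem bumpConst_nonneg (n : ℕ) : 0 ≤ bumpConst n :=
  mul_nonneg (by positivity) (tsum_nonneg fun j => by positivity)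

theorem integral_one_add_pow_inv_le {n : ℕ} {K : Set (EuclideanSpace ℝ (Fin n))}
    (hK : Convex ℝ K) (hKc : IsCompact K)
    {y : EuclideanSpace ℝ (Fin n)} (hy : y ∈ K) {g : EuclideanSpace ℝ (Fin n) → ℝ}
    (hgc : Continuous g) (hg0 : ∀ x, 0 ≤ g x)
    (hg : ∀ x, ∀ r ∈ Icc (0 : ℝ) 1, g (y + r • (x - y)) = r * g x) :
    ∫ x in K, 1 / (1 + g x) ^ (n + 2) ≤
      bumpConst n * volume.real (K ∩ {x | g x ≤ 1 / 16}) := by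
  have hfin : volume (K ∩ {x | g x ≤ 1 / 16}) ≠ ∞ :=
    ((measure_mono inter_subset_left).trans_lt hKc.measure_lt_top).ne
  rw [integral_eq_lintegral_of_nonneg_ae]
  · have := lintegral_one_add_pow_inv_le hK hy hgc hg0 hg
      (a := 1 / 16) (by norm_num) (by norm_num)
    have h2 := ENNReal.toReal_mono (ENNReal.mul_ne_top ENNReal.ofReal_ne_top hfin) this
    rwa [ENNReal.toReal_mul, ← bumpConst, ENNReal.toReal_ofReal (bumpConst_nonneg n)] at h2
  · refine Filter.Eventually.of_forall fun x => ?_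
    have := hg0 x
    simp only [Pi.zero_apply]
    positivity
  · refine (Continuous.aestronglyMeasurable ?_)
    refine continuous_const.div (by fun_prop) fun x => ?_
    have := hg0 x
    positivity

/-- If the core were null, the growth bound would make every larger sublevel set null, hence `K`
too, as `g` is bounded on `K`. -/
theorem volume_real_sublevel_pos {n : ℕ} {K : Set (EuclideanSpace ℝ (Fin n))}
    (hK : Convex ℝ K) (hKc : IsCompact K) (hKi : (interior K).Nonempty)
    {y : EuclideanSpace ℝ (Fin n)} (hy : y ∈ K) {g : EuclideanSpace ℝ (Fin n) → ℝ}
    (hgc : Continuous g)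
    (hg : ∀ x, ∀ r ∈ Icc (0 : ℝ) 1, g (y + r • (x - y)) = r * g x) :
    0 < volume.real (K ∩ {x | g x ≤ 1 / 16}) := by
  have hfin : volume (K ∩ {x | g x ≤ 1 / 16}) ≠ ∞ :=
    ((measure_mono inter_subset_left).trans_lt hKc.measure_lt_top).ne
  refine ENNReal.toReal_pos (fun h0 => ?_) hfin
  obtain ⟨b, hb⟩ := hKc.bddAbove_image hgc.continuousOn
  have h := volume_sublevel_le hK hy hg (a := 1 / 16) (b := max b 1) (by norm_num)
    (le_trans (by norm_num) (le_max_right _ _))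
  rw [h0, mul_zero, nonpos_iff_eq_zero] at h
  have hsub : K ⊆ K ∩ {x | g x ≤ max b 1} := fun x hx =>
    ⟨hx, (hb (mem_image_of_mem g hx)).trans (le_max_left _ _)⟩
  exact (Measure.measure_pos_of_nonempty_interior volume hKi).ne' (measure_mono_null hsub h)

/-- A function on a convex body that is comparable to a bump around `y` has second moment
comparable to its mass. -/
theorem integral_sq_mul_le {n : ℕ} {K : Set (EuclideanSpace ℝ (Fin n))}
    (hK : Convex ℝ K) (hKc : IsCompact K)
    {y : EuclideanSpace ℝ (Fin n)} (hy : y ∈ K) {g q : EuclideanSpace ℝ (Fin n) → ℝ}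
    (hgc : Continuous g) (hg0 : ∀ x, 0 ≤ g x)
    (hg : ∀ x, ∀ r ∈ Icc (0 : ℝ) 1, g (y + r • (x - y)) = r * g x)
    (hqc : Continuous q) {B b : ℝ} (hB : 0 ≤ B) (hb : 0 < b) (hq0 : ∀ x ∈ K, 0 ≤ q x)
    (hqB : ∀ x ∈ K, q x * (1 + g x) ^ (n + 4) ≤ B) (hqb : ∀ x ∈ K, g x ≤ 1 / 16 → b ≤ q x) :
    b * volume.real (K ∩ {x | g x ≤ 1 / 16}) ≤ ∫ x in K, q x ∧
    ∫ x in K, q x ≤ B * bumpConst n * volume.real (K ∩ {x | g x ≤ 1 / 16}) ∧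
    ∫ x in K, (g x) ^ 2 * q x ≤ B * bumpConst n / b * ∫ x in K, q x := by
  have hKm := hKc.measurableSet
  have hSm : MeasurableSet (K ∩ {x | g x ≤ 1 / 16}) :=
    hKm.inter (isClosed_le hgc continuous_const).measurableSet
  have hqi : IntegrableOn q K := hqc.continuousOn.integrableOn_compact hKc
  have hpc : Continuous fun x => B * (1 / (1 + g x) ^ (n + 2)) := by
    refine continuous_const.mul (continuous_const.div (by fun_prop) fun x => ?_)
    have := hg0 x
    positivity
  have h1 : b * volume.real (K ∩ {x | g x ≤ 1 / 16}) ≤ ∫ x in K, q x := by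
    have hfin : volume (K ∩ {x | g x ≤ 1 / 16}) ≠ ∞ :=
      ((measure_mono inter_subset_left).trans_lt hKc.measure_lt_top).ne
    calc b * volume.real (K ∩ {x | g x ≤ 1 / 16}) = ∫ x in K ∩ {x | g x ≤ 1 / 16}, b := by
          rw [setIntegral_const, smul_eq_mul, mul_comm]
      _ ≤ ∫ x in K ∩ {x | g x ≤ 1 / 16}, q x :=
          setIntegral_mono_on (integrableOn_const hfin) (hqi.mono_set inter_subset_left) hSm
            fun x hx => hqb x hx.1 hx.2
      _ ≤ ∫ x in K, q x := setIntegral_mono_set hqi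
          ((ae_restrict_iff' hKm).2 (Filter.Eventually.of_forall hq0))
          (Filter.Eventually.of_forall inter_subset_left)
  -- Of the `n + 4` powers of decay, two absorb the factor `(1 + g)²`. This covers both the mass `f
  -- = q` and the second moment `f = g² q`.
  have hle : ∀ f : EuclideanSpace ℝ (Fin n) → ℝ, Continuous f →
      (∀ x ∈ K, f x ≤ (1 + g x) ^ 2 * q x) →
      ∫ x in K, f x ≤ B * bumpConst n * volume.real (K ∩ {x | g x ≤ 1 / 16}) := by
    intro f hf hfq
    calc ∫ x in K, f x ≤ ∫ x in K, B * (1 / (1 + g x) ^ (n + 2)) := by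
          refine setIntegral_mono_on (hf.continuousOn.integrableOn_compact hKc)
            (hpc.continuousOn.integrableOn_compact hKc) hKm fun x hx => (hfq x hx).trans ?_
          have := hg0 x
          rw [mul_one_div, le_div_iff₀ (by positivity)]
          refine le_trans (le_of_eq ?_) (hqB x hx)
          ring
      _ ≤ _ := by
          rw [integral_const_mul, mul_assoc]
          exact mul_le_mul_of_nonneg_left (integral_one_add_pow_inv_le hK hKc hy hgc hg0 hg) hB
  refine ⟨h1, hle q hqc fun x hx => ?_, (hle (fun x => g x ^ 2 * q x) (by fun_prop)
    fun x hx => ?_).trans ?_⟩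
  · exact le_mul_of_one_le_left (hq0 x hx) (one_le_pow₀ (by linarith [hg0 x]))
  · have := hg0 x
    have := hq0 x hx
    show g x ^ 2 * q x ≤ _
    gcongr
    linarith
  · rw [div_mul_eq_mul_div, le_div_iff₀ hb, mul_assoc]
    refine mul_le_mul_of_nonneg_left ?_ (mul_nonneg hB (bumpConst_nonneg n))
    rwa [mul_comm]

/-! ### Polynomial functions on `ℝⁿ` -/

/-- `f` is a polynomial function of degree at most `d`. -/
def IsPolynomialFun {n : ℕ} (d : ℕ) (f : EuclideanSpace ℝ (Fin n) → ℝ) : Prop :=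
  ∃ P : MvPolynomial (Fin n) ℝ, P.totalDegree ≤ d ∧
    ∀ x : EuclideanSpace ℝ (Fin n), MvPolynomial.eval (fun i => x i) P = f x

namespace IsPolynomialFun

variable {n : ℕ} {d e : ℕ} {f g : EuclideanSpace ℝ (Fin n) → ℝ}

theorem mono (hf : IsPolynomialFun d f) (h : d ≤ e) : IsPolynomialFun e f := by
  obtain ⟨P, hP, hPf⟩ := hf
  exact ⟨P, hP.trans h, hPf⟩

theorem const (c : ℝ) : IsPolynomialFun 0 fun _ : EuclideanSpace ℝ (Fin n) => c :=
  ⟨MvPolynomial.C c, by simp, fun x => by simp⟩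

theorem mul (hf : IsPolynomialFun d f) (hg : IsPolynomialFun e g) :
    IsPolynomialFun (d + e) fun x => f x * g x := by
  obtain ⟨P, hP, hPf⟩ := hf
  obtain ⟨Q, hQ, hQg⟩ := hg
  exact ⟨P * Q, (MvPolynomial.totalDegree_mul P Q).trans (add_le_add hP hQ), fun x => by
    rw [map_mul, hPf, hQg]⟩

theorem pow (hf : IsPolynomialFun d f) (k : ℕ) : IsPolynomialFun (k * d) fun x => f x ^ k := by
  obtain ⟨P, hP, hPf⟩ := hf
  exact ⟨P ^ k, (MvPolynomial.totalDegree_pow P k).trans (Nat.mul_le_mul_left k hP), fun x => by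
    rw [map_pow, hPf]⟩

theorem sum {ι : Type*} (s : Finset ι) {f : ι → EuclideanSpace ℝ (Fin n) → ℝ}
    (hf : ∀ i ∈ s, IsPolynomialFun d (f i)) : IsPolynomialFun d fun x => ∑ i ∈ s, f i x := by
  choose! P hP hPf using hf
  exact ⟨∑ i ∈ s, P i, MvPolynomial.totalDegree_finsetSum_le hP, fun x => by
    rw [map_sum]; exact Finset.sum_congr rfl fun i hi => hPf i hi x⟩

theorem prod {ι : Type*} (s : Finset ι) {f : ι → EuclideanSpace ℝ (Fin n) → ℝ}
    (hf : ∀ i ∈ s, IsPolynomialFun d (f i)) :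
    IsPolynomialFun (s.card * d) fun x => ∏ i ∈ s, f i x := by
  choose! P hP hPf using hf
  refine ⟨∏ i ∈ s, P i, (MvPolynomial.totalDegree_finsetProd s P).trans ?_, fun x => by
    rw [map_prod]; exact Finset.prod_congr rfl fun i hi => hPf i hi x⟩
  simpa using Finset.sum_le_card_nsmul s _ d hP

theorem add (hf : IsPolynomialFun d f) (hg : IsPolynomialFun d g) :
    IsPolynomialFun d fun x => f x + g x := by
  obtain ⟨P, hP, hPf⟩ := hf
  obtain ⟨Q, hQ, hQg⟩ := hg
  exact ⟨P + Q, (MvPolynomial.totalDegree_add P Q).trans (max_le hP hQ), fun x => by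
    rw [map_add, hPf, hQg]⟩

theorem polynomial_eval (hf : IsPolynomialFun 1 f) {p : Polynomial ℝ} (hp : p.natDegree ≤ d) :
    IsPolynomialFun d fun x => p.eval (f x) := by
  have : (fun x => p.eval (f x)) =
      fun x => ∑ i ∈ Finset.range (d + 1), p.coeff i * f x ^ i := by
    funext x
    exact Polynomial.eval_eq_sum_range' (Nat.lt_succ_of_le hp) _
  rw [this]
  refine sum _ fun i hi => ?_
  refine ((const (p.coeff i)).mul (hf.pow i)).mono ?_
  rw [Finset.mem_range] at hi
  omega

theorem inner_add (a : EuclideanSpace ℝ (Fin n)) (b : ℝ) :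
    IsPolynomialFun 1 fun x : EuclideanSpace ℝ (Fin n) => inner ℝ a x + b := by
  refine add ?_ ((const b).mono zero_le_one)
  have : (fun x : EuclideanSpace ℝ (Fin n) => inner ℝ a x) = fun x => ∑ i, a i * x i := by
    funext x
    simp [PiLp.inner_apply, mul_comm]
  change IsPolynomialFun 1 fun x => inner ℝ a x
  rw [this]
  refine sum _ fun i _ => ?_
  have h : IsPolynomialFun 1 fun x : EuclideanSpace ℝ (Fin n) => x i :=
    ⟨MvPolynomial.X i, (MvPolynomial.totalDegree_X i).le, fun x => by simp⟩
  exact ((const (a i)).mul h).mono (by omega)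

theorem continuous (hf : IsPolynomialFun d f) : Continuous f := by
  obtain ⟨P, -, hPf⟩ := hf
  rw [← funext hPf]
  exact (MvPolynomial.continuous_eval P).comp (by fun_prop)

end IsPolynomialFun

/-! ### Cubature formulas and normalized Lebesgue measure -/

theorem WeightedPoints.IsCubature.integral_eq {n : ℕ} {F : WeightedPoints n}
    {μ : Measure (EuclideanSpace ℝ (Fin n))} {t : ℕ} (hF : F.IsCubature μ t)
    {f : EuclideanSpace ℝ (Fin n) → ℝ} (hf : IsPolynomialFun t f) :
    ∫ x, f x ∂μ = ∑ p ∈ F.points, F.weight p * f p := by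
  obtain ⟨P, hP, hPf⟩ := hf
  simpa only [hPf] using hF P hP

theorem integral_uniformMeasure {n : ℕ} (K : Set (EuclideanSpace ℝ (Fin n)))
    (f : EuclideanSpace ℝ (Fin n) → ℝ) :
    ∫ x, f x ∂uniformMeasure K = (volume.real K)⁻¹ * ∫ x in K, f x := by
  rw [uniformMeasure, ProbabilityTheory.cond, integral_smul_measure, smul_eq_mul,
    ENNReal.toReal_inv]
  rfl

theorem volume_real_pos_of_interior {n : ℕ} {K : Set (EuclideanSpace ℝ (Fin n))}
    (hKc : IsCompact K) (hKi : (interior K).Nonempty) : 0 < volume.real K :=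
  ENNReal.toReal_pos (Measure.measure_pos_of_nonempty_interior volume hKi).ne'
    hKc.measure_lt_top.ne

theorem Finset.one_add_sum_le_prod_one_add {ι : Type*} (s : Finset ι) {u : ι → ℝ}
    (hu : ∀ k, 0 ≤ u k) : 1 + ∑ k ∈ s, u k ≤ ∏ k ∈ s, (1 + u k) := by
  classical
  induction s using Finset.induction_on with
  | empty => simp
  | insert a s ha ih =>
    rw [Finset.sum_insert ha, Finset.prod_insert ha]
    have := Finset.sum_nonneg fun k (_ : k ∈ s) => hu k
    nlinarith [hu a, mul_nonneg (hu a) this]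

/-! ### The product kernel attached to a family of affine functions -/

section ProductKernel

variable {n : ℕ} {ι : Type*} [Fintype ι]

/-- The normalized distance from `y` measured by the functions `f k`. -/
noncomputable def normalizedDist (M : ℕ) (f : ι → EuclideanSpace ℝ (Fin n) → ℝ)
    (y x : EuclideanSpace ℝ (Fin n)) : ℝ :=
  ∑ k, |f k x - f k y| / fejerWidth M (f k y)

/-- A product of powers of Fejér kernels, centred at `y`. -/
noncomputable def productKernel (m M : ℕ) (f : ι → EuclideanSpace ℝ (Fin n) → ℝ)
    (y x : EuclideanSpace ℝ (Fin n)) : ℝ :=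
  ∏ k, ((fejerPoly M (f k y)).eval (f k x)) ^ m

theorem isPolynomialFun_productKernel (m M : ℕ) {f : ι → EuclideanSpace ℝ (Fin n) → ℝ}
    (hf : ∀ k, IsPolynomialFun 1 (f k)) (y : EuclideanSpace ℝ (Fin n)) :
    IsPolynomialFun (Fintype.card ι * (m * M)) (productKernel m M f y) :=
  IsPolynomialFun.prod Finset.univ fun k _ =>
    ((hf k).polynomial_eval (natDegree_fejerPoly_le M (f k y))).pow m

/-- The even exponent gives positivity on all of `ℝⁿ`; off `K` the factors themselves may be
negative, and nodes may lie there. -/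
theorem productKernel_nonneg {m : ℕ} (hm : Even m) (M : ℕ)
    (f : ι → EuclideanSpace ℝ (Fin n) → ℝ) (y x : EuclideanSpace ℝ (Fin n)) :
    0 ≤ productKernel m M f y x :=
  Finset.prod_nonneg fun _ _ => hm.pow_nonneg _

theorem normalizedDist_nonneg {M : ℕ} (hM : 1 ≤ M) (f : ι → EuclideanSpace ℝ (Fin n) → ℝ)
    (y x : EuclideanSpace ℝ (Fin n)) : 0 ≤ normalizedDist M f y x :=
  Finset.sum_nonneg fun _ _ => div_nonneg (abs_nonneg _) (fejerWidth_pos hM _).le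

theorem normalizedDist_homogeneous (M : ℕ) {a : ι → EuclideanSpace ℝ (Fin n)} {b : ι → ℝ}
    (y x : EuclideanSpace ℝ (Fin n)) {r : ℝ} (hr : 0 ≤ r) :
    normalizedDist M (fun k x => inner ℝ (a k) x + b k) y (y + r • (x - y)) =
      r * normalizedDist M (fun k x => inner ℝ (a k) x + b k) y x := by
  unfold normalizedDist
  rw [Finset.mul_sum]
  refine Finset.sum_congr rfl fun k _ => ?_
  have : inner ℝ (a k) (y + r • (x - y)) + b k - (inner ℝ (a k) y + b k) =
      r * (inner ℝ (a k) x + b k - (inner ℝ (a k) y + b k)) := by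
    rw [inner_add_right, inner_smul_right, inner_sub_right]
    ring
  rw [this, abs_mul, abs_of_nonneg hr, mul_div_assoc]

theorem productKernel_mul_le {m M : ℕ} (hM : 1 ≤ M) {f : ι → EuclideanSpace ℝ (Fin n) → ℝ}
    {y x : EuclideanSpace ℝ (Fin n)} (hx : ∀ k, f k x ∈ Icc (-1 : ℝ) 1)
    (hy : ∀ k, f k y ∈ Icc (-1 : ℝ) 1) :
    productKernel m M f y x * (1 + normalizedDist M f y x) ^ m ≤
      (8 : ℝ) ^ (m * Fintype.card ι) := by
  have h0 : ∀ k, 0 ≤ |f k x - f k y| / fejerWidth M (f k y) := fun k =>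
    div_nonneg (abs_nonneg _) (fejerWidth_pos hM _).le
  have hq : ∀ k, 0 ≤ (fejerPoly M (f k y)).eval (f k x) := fun k =>
    eval_fejerPoly_nonneg M (hx k) (hy k)
  have h1 := normalizedDist_nonneg hM f y x
  calc productKernel m M f y x * (1 + normalizedDist M f y x) ^ m
      ≤ productKernel m M f y x * (∏ k, (1 + |f k x - f k y| / fejerWidth M (f k y))) ^ m := by
        refine mul_le_mul_of_nonneg_left ?_ (Finset.prod_nonneg fun k _ => pow_nonneg (hq k) m)
        exact pow_le_pow_left₀ (add_nonneg zero_le_one h1) (Finset.one_add_sum_le_prod_one_add _ h0) m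
    _ = ∏ k, ((fejerPoly M (f k y)).eval (f k x) *
          (1 + |f k x - f k y| / fejerWidth M (f k y))) ^ m := by
        rw [productKernel, ← Finset.prod_pow, ← Finset.prod_mul_distrib]
        exact Finset.prod_congr rfl fun k _ => (mul_pow _ _ _).symm
    _ ≤ ∏ _ : ι, (8 : ℝ) ^ m := by
        refine Finset.prod_le_prod (fun k _ => pow_nonneg (mul_nonneg (hq k) ?_) m) fun k _ =>
          pow_le_pow_left₀ (mul_nonneg (hq k) ?_) (eval_fejerPoly_mul_le hM (hx k) (hy k)) m
        all_goals linarith [h0 k]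
    _ = _ := by rw [Finset.prod_const, Finset.card_univ, pow_mul]

theorem le_productKernel {m M : ℕ} (hM : 1 ≤ M) {f : ι → EuclideanSpace ℝ (Fin n) → ℝ}
    {y x : EuclideanSpace ℝ (Fin n)} (hx : ∀ k, f k x ∈ Icc (-1 : ℝ) 1)
    (hy : ∀ k, f k y ∈ Icc (-1 : ℝ) 1) (hxy : normalizedDist M f y x ≤ 1 / 16) :
    (1 / 4 : ℝ) ^ (m * Fintype.card ι) ≤ productKernel m M f y x := by
  have : (1 / 4 : ℝ) ^ (m * Fintype.card ι) = ∏ _ : ι, (1 / 4 : ℝ) ^ m := by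
    rw [Finset.prod_const, Finset.card_univ, pow_mul]
  rw [this]
  refine Finset.prod_le_prod (fun _ _ => by positivity) fun k _ =>
    pow_le_pow_left₀ (by norm_num) (le_eval_fejerPoly hM (hx k) (hy k) (le_trans ?_ hxy)) m
  exact Finset.single_le_sum (f := fun k => |f k x - f k y| / fejerWidth M (f k y))
    (fun k _ => div_nonneg (abs_nonneg _) (fejerWidth_pos hM _).le) (Finset.mem_univ k)

/-- The constant in the concentration estimate for the product kernel. -/
noncomputable def kernelConst (n N : ℕ) : ℝ :=
  8 ^ (2 * (n + 2) * N) * bumpConst n / (1 / 4 : ℝ) ^ (2 * (n + 2) * N)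

theorem kernelConst_nonneg (n N : ℕ) : 0 ≤ kernelConst n N :=
  div_nonneg (mul_nonneg (by positivity) (bumpConst_nonneg n)) (by positivity)

/-- The exponent `2 (n + 2)` is even, for positivity, and at least `n + 4`, for the second moment.
The constants do not depend on `y` or `M`. -/
theorem productKernel_concentration {K : Set (EuclideanSpace ℝ (Fin n))} (hK : Convex ℝ K)
    (hKc : IsCompact K) (hKi : (interior K).Nonempty) {a : ι → EuclideanSpace ℝ (Fin n)}
    {b : ι → ℝ} {f : ι → EuclideanSpace ℝ (Fin n) → ℝ}
    (hf : f = fun k x => inner ℝ (a k) x + b k) (hfK : ∀ x ∈ K, ∀ k, f k x ∈ Icc (-1 : ℝ) 1)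
    {y : EuclideanSpace ℝ (Fin n)} (hy : y ∈ K) {M : ℕ} (hM : 1 ≤ M) :
    0 < ∫ x in K, productKernel (2 * (n + 2)) M f y x ∧
    ∫ x in K, productKernel (2 * (n + 2)) M f y x ≤
      8 ^ (2 * (n + 2) * Fintype.card ι) * bumpConst n *
        volume.real (K ∩ {x | normalizedDist M f y x ≤ 1 / 16}) ∧
    ∫ x in K, normalizedDist M f y x ^ 2 * productKernel (2 * (n + 2)) M f y x ≤
      kernelConst n (Fintype.card ι) * ∫ x in K, productKernel (2 * (n + 2)) M f y x := by
  have hfp : ∀ k, IsPolynomialFun 1 (f k) := fun k => hf ▸ IsPolynomialFun.inner_add (a k) (b k)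
  have hgc : Continuous (normalizedDist M f y) := by
    unfold normalizedDist
    have := fun k => (hfp k).continuous
    fun_prop
  have hg0 := normalizedDist_nonneg hM f y
  have hgh : ∀ x, ∀ r ∈ Icc (0 : ℝ) 1,
      normalizedDist M f y (y + r • (x - y)) = r * normalizedDist M f y x := fun x r hr => by
    rw [hf]; exact normalizedDist_homogeneous M y x hr.1
  have hm : Even (2 * (n + 2)) := even_two_mul _
  have hq0 := productKernel_nonneg hm M f y
  obtain ⟨h1, h2, h3⟩ := integral_sq_mul_le hK hKc hy hgc hg0 hgh
    (isPolynomialFun_productKernel (2 * (n + 2)) M hfp y).continuous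
    (B := 8 ^ (2 * (n + 2) * Fintype.card ι)) (by positivity)
    (b := (1 / 4 : ℝ) ^ (2 * (n + 2) * Fintype.card ι)) (by positivity) (fun x _ => hq0 x)
    (fun x hx => le_trans (mul_le_mul_of_nonneg_left (pow_le_pow_right₀
      (by linarith [hg0 x]) (by omega)) (hq0 x))
      (productKernel_mul_le (m := 2 * (n + 2)) hM (hfK x hx) (hfK y hy)))
    (fun x hx hxg => le_productKernel hM (hfK x hx) (hfK y hy) hxg)
  exact ⟨lt_of_lt_of_le (mul_pos (by positivity)
    (volume_real_sublevel_pos hK hKc hKi hy hgc hgh)) h1, h2, h3⟩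

/-- A positive cubature formula has a point that is close to a given point of the convex body,
as measured by finitely many affine functions. -/
theorem exists_point_near {K : Set (EuclideanSpace ℝ (Fin n))} (hK : Convex ℝ K)
    (hKc : IsCompact K) (hKi : (interior K).Nonempty) {a : ι → EuclideanSpace ℝ (Fin n)}
    {b : ι → ℝ} {f : ι → EuclideanSpace ℝ (Fin n) → ℝ}
    (hf : f = fun k x => inner ℝ (a k) x + b k) (hfK : ∀ x ∈ K, ∀ k, f k x ∈ Icc (-1 : ℝ) 1)
    {y : EuclideanSpace ℝ (Fin n)} (hy : y ∈ K) {M t : ℕ} (hM : 1 ≤ M)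
    (ht : 2 + Fintype.card ι * (2 * (n + 2) * M) ≤ t) {F : WeightedPoints n}
    (hF : F.IsCubature (uniformMeasure K) t) (hFp : F.IsPositive) :
    ∃ p ∈ F.points, ∀ k, |f k p - f k y| ≤
      √(kernelConst n (Fintype.card ι) + 1) * fejerWidth M (f k y) := by
  obtain ⟨h1, -, h3⟩ := productKernel_concentration hK hKc hKi hf hfK hy hM
  set A := kernelConst n (Fintype.card ι)
  set q := productKernel (2 * (n + 2)) M f y
  have hq0 : ∀ x, 0 ≤ q x := productKernel_nonneg (even_two_mul _) M f y
  -- A polynomial substitute for the square of `normalizedDist`, whose absolute values are not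
  -- polynomial.
  set D : EuclideanSpace ℝ (Fin n) → ℝ := fun x =>
    ∑ k, ((fejerWidth M (f k y))⁻¹ * (f k x + -f k y)) ^ 2 with hD
  have hfp : ∀ k, IsPolynomialFun 1 (f k) := fun k => hf ▸ IsPolynomialFun.inner_add (a k) (b k)
  have hDp : IsPolynomialFun 2 D := IsPolynomialFun.sum _ fun k _ =>
    (((IsPolynomialFun.const _).mul ((hfp k).add
      ((IsPolynomialFun.const _).mono zero_le_one))).pow 2).mono (by omega)
  have hqp : IsPolynomialFun (Fintype.card ι * (2 * (n + 2) * M)) q :=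
    isPolynomialFun_productKernel _ M hfp y
  have hDg : ∀ x, D x ≤ normalizedDist M f y x ^ 2 := by
    intro x
    have e : D x = ∑ k, (|f k x - f k y| / fejerWidth M (f k y)) ^ 2 := by
      refine Finset.sum_congr rfl fun k _ => ?_
      rw [div_pow, sq_abs, mul_pow, inv_pow, ← sub_eq_add_neg, inv_mul_eq_div]
    rw [e]
    exact Finset.sum_sq_le_sq_sum_of_nonneg fun k _ =>
      div_nonneg (abs_nonneg _) (fejerWidth_pos hM _).le
  -- The test polynomial: nonpositive wherever `D ≥ A + 1`, yet of positive integral because the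
  -- second moment is at most `A` times the mass.
  have hRp : IsPolynomialFun t fun x => ((A + 1) + (-1) * D x) * q x :=
    ((((IsPolynomialFun.const (A + 1)).mono (by omega)).add
      (((IsPolynomialFun.const (-1)).mul hDp).mono (by omega))).mul hqp).mono ht
  have hpos : 0 < ∫ x, ((A + 1) + (-1) * D x) * q x ∂uniformMeasure K := by
    rw [integral_uniformMeasure]
    refine mul_pos (inv_pos.2 (volume_real_pos_of_interior hKc hKi)) ?_
    have hi : ∀ {g : EuclideanSpace ℝ (Fin n) → ℝ}, Continuous g → IntegrableOn g K := fun hg =>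
      hg.continuousOn.integrableOn_compact hKc
    have hqc := hqp.continuous
    have hDc := hDp.continuous
    have hgc : Continuous (normalizedDist M f y) := by
      unfold normalizedDist
      have := fun k => (hfp k).continuous
      fun_prop
    have e : ∀ x, ((A + 1) + (-1) * D x) * q x = (A + 1) * q x - D x * q x := fun x => by ring
    simp only [e]
    rw [integral_sub (hi (by fun_prop)) (hi (by fun_prop)), integral_const_mul]
    have h4 : ∫ x in K, D x * q x ≤ ∫ x in K, normalizedDist M f y x ^ 2 * q x :=
      setIntegral_mono (hi (by fun_prop)) (hi (by fun_prop)) fun x =>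
        mul_le_mul_of_nonneg_right (hDg x) (hq0 x)
    linarith
  rw [hF.integral_eq hRp] at hpos
  obtain ⟨p, hp, hpp⟩ := Finset.exists_lt_of_sum_lt (s := F.points) (f := fun _ => (0 : ℝ))
    (g := fun p => F.weight p * (((A + 1) + (-1) * D p) * q p)) (by simpa using hpos)
  refine ⟨p, hp, fun k => ?_⟩
  have hDA : D p ≤ A + 1 := by
    by_contra! h
    have : ((A + 1) + (-1) * D p) * q p ≤ 0 :=
      mul_nonpos_of_nonpos_of_nonneg (by linarith) (hq0 p)
    exact absurd hpp (not_lt.2 (mul_nonpos_of_nonneg_of_nonpos (hFp p hp).le this))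
  have hδ := fejerWidth_pos hM (f k y)
  have h5 : ((fejerWidth M (f k y))⁻¹ * (f k p + -f k y)) ^ 2 ≤ A + 1 :=
    le_trans (Finset.single_le_sum
      (f := fun k => ((fejerWidth M (f k y))⁻¹ * (f k p + -f k y)) ^ 2)
      (fun k _ => sq_nonneg _) (Finset.mem_univ k)) hDA
  have h6 := Real.abs_le_sqrt h5
  rw [abs_mul, abs_inv, abs_of_pos hδ, inv_mul_eq_div, div_le_iff₀ hδ] at h6
  rwa [sub_eq_add_neg]

end ProductKernel

/-! ### Facets of polytopes -/

section Polytope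

variable {n : ℕ}

theorem infDist_hyperplane (c : EuclideanSpace ℝ (Fin n)) (hc : c ≠ 0) (β : ℝ)
    (x : EuclideanSpace ℝ (Fin n)) :
    Metric.infDist x {z | inner ℝ c z = β} = |inner ℝ c x - β| / ‖c‖ := by
  have hc0 : 0 < ‖c‖ := norm_pos_iff.2 hc
  have hmem : x - ((inner ℝ c x - β) / ‖c‖ ^ 2) • c ∈ {z | inner ℝ c z = β} := by
    rw [mem_ofPred_eq, inner_sub_right, inner_smul_right, real_inner_self_eq_norm_sq]
    field_simp
    ring
  refine le_antisymm ?_ ((Metric.le_infDist ⟨_, hmem⟩).2 fun z hz => ?_)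
  · refine (Metric.infDist_le_dist_of_mem hmem).trans (le_of_eq ?_)
    rw [dist_eq_norm, sub_sub_cancel, norm_smul, Real.norm_eq_abs, abs_div,
      abs_of_pos (by positivity : 0 < ‖c‖ ^ 2)]
    field_simp
  · rw [div_le_iff₀ hc0, ← (show inner ℝ c z = β from hz), ← inner_sub_right, dist_eq_norm, mul_comm]
    exact abs_real_inner_le_norm c (x - z)

/-- On a convex body the coordinate of a facet is a nonnegative affine function. -/
theorem IsFacet.exists_facetDist_eq {K Φ : Set (EuclideanSpace ℝ (Fin n))}
    (hKi : (interior K).Nonempty) (hΦ : IsFacet K Φ) :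
    ∃ (a : EuclideanSpace ℝ (Fin n)) (b : ℝ), ∀ x ∈ K, facetDist Φ x = inner ℝ a x + b := by
  obtain ⟨⟨w, hw⟩, hexp, hdim⟩ := hΦ
  obtain ⟨l, hl⟩ := hexp ⟨w, hw⟩
  have hwl := hw
  rw [hl] at hwl
  set c := (InnerProductSpace.toDual ℝ (EuclideanSpace ℝ (Fin n))).symm l with hcdef
  have hlc : ∀ x, l x = inner ℝ c x := fun x =>
    (InnerProductSpace.toDual_symm_apply (y := l) (x := x)).symm
  have hΦl : ∀ x ∈ Φ, l x = l w := fun x hx => by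
    rw [hl] at hx
    exact le_antisymm (hwl.2 x hx.1) (hx.2 w hwl.1)
  have hl0 : l ≠ 0 := by
    rintro rfl
    have hΦK : Φ = K := by rw [hl]; simp
    have htop : vectorSpan ℝ K = ⊤ := by
      rw [← direction_affineSpan, (affineSpan_eq_top_of_nonempty_interior
        (hKi.mono (interior_mono (subset_convexHull ℝ K)))), AffineSubspace.direction_top]
    rw [hΦK, htop, finrank_top, finrank_euclideanSpace_fin] at hdim
    omega
  have hc : c ≠ 0 := by
    intro h
    exact hl0 (by ext x; rw [hlc, h, inner_zero_left]; rfl)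
  -- Both spaces have dimension `n - 1`, so the span of the facet is a level set of `l`, and `K`
  -- lies on one side of it.
  have hker : vectorSpan ℝ Φ = l.toLinearMap.ker := by
    refine Submodule.eq_of_le_of_finrank_eq ?_ ?_
    · refine Submodule.span_le.2 ?_
      rintro _ ⟨x, hx, z, hz, rfl⟩
      simp [hΦl x hx, hΦl z hz]
    · have h1 := Module.Dual.finrank_ker_add_one_of_ne_zero (f := l.toLinearMap)
        (fun h => hl0 (by ext x; exact LinearMap.congr_fun h x))
      rw [finrank_euclideanSpace_fin] at h1
      omega
  have hspan : (affineSpan ℝ Φ : Set (EuclideanSpace ℝ (Fin n))) = {z | inner ℝ c z = l w} := by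
    ext z
    rw [SetLike.mem_coe, ← AffineSubspace.vsub_right_mem_direction_iff_mem (mem_affineSpan ℝ hw),
      direction_affineSpan, hker, mem_ofPred_eq, ← hlc]
    simp [sub_eq_zero]
  refine ⟨-(‖c‖⁻¹ • c), ‖c‖⁻¹ * l w, fun x hx => ?_⟩
  have hle : inner ℝ c x ≤ l w := by rw [← hlc]; exact hwl.2 x hx
  rw [facetDist, hspan, infDist_hyperplane c hc, abs_of_nonpos (by linarith), inner_neg_left,
    real_inner_smul_left]
  ring

/-- Active constraints do not change along `u`, and inactive ones stay strict for small `ε` of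
either sign. -/
theorem eventually_add_smul_mem {H : Finset (EuclideanSpace ℝ (Fin n) × ℝ)}
    {v u : EuclideanSpace ℝ (Fin n)} (hv : ∀ h ∈ H, inner ℝ h.1 v ≤ h.2)
    (hu : ∀ h ∈ H, inner ℝ h.1 v = h.2 → inner ℝ h.1 u = 0) :
    ∀ᶠ ε : ℝ in nhds 0, ∀ h ∈ H, inner ℝ h.1 (v + ε • u) ≤ h.2 := by
  rw [Filter.eventually_all_finset]
  intro h hh
  rcases (hv h hh).eq_or_lt with h1 | h1
  · refine Filter.Eventually.of_forall fun ε => ?_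
    rw [inner_add_right, inner_smul_right, hu h hh h1, mul_zero, add_zero, h1]
  · have hc : Continuous fun ε : ℝ => inner ℝ h.1 (v + ε • u) := by fun_prop
    have := hc.continuousAt.eventually_lt (x₀ := (0 : ℝ)) (continuousAt_const (y := h.2))
      (by simpa using h1)
    exact this.mono fun ε hε => le_of_lt hε

/-- The point plays the role of a relative interior point of `Φ`: taking a midpoint with a point
where one more constraint is slack makes that constraint slack and keeps the others slack. -/
theorem exists_mem_forall_inner_lt {H : Finset (EuclideanSpace ℝ (Fin n) × ℝ)}
    {Φ : Set (EuclideanSpace ℝ (Fin n))} (hΦ : Φ.Nonempty) (hΦc : Convex ℝ Φ)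
    (hΦH : ∀ x ∈ Φ, ∀ h ∈ H, inner ℝ h.1 x ≤ h.2) :
    ∃ x ∈ Φ, ∀ h ∈ H, inner ℝ h.1 x = h.2 → ∀ z ∈ Φ, inner ℝ h.1 z = h.2 := by
  classical
  induction H using Finset.induction_on with
  | empty => exact ⟨_, hΦ.some_mem, by simp⟩
  | insert k H _ ih =>
    obtain ⟨x, hx, hxH⟩ := ih fun x hx h hh => hΦH x hx h (Finset.mem_insert_of_mem hh)
    by_cases hk : ∀ z ∈ Φ, inner ℝ k.1 z = k.2
    · refine ⟨x, hx, fun h hh => ?_⟩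
      rcases Finset.mem_insert.1 hh with rfl | hh
      · exact fun _ => hk
      · exact hxH h hh
    · push Not at hk
      obtain ⟨z, hz, hzk⟩ := hk
      refine ⟨midpoint ℝ x z, hΦc.midpoint_mem hx hz, fun h hh => ?_⟩
      have e : inner ℝ h.1 (midpoint ℝ x z) = (inner ℝ h.1 x + inner ℝ h.1 z) / 2 := by
        rw [midpoint_eq_smul_add, inner_smul_right, inner_add_right, invOf_eq_inv]
        ring
      rw [e]
      have h1 := hΦH x hx h hh
      have h2 := hΦH z hz h hh
      rcases Finset.mem_insert.1 hh with rfl | hh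
      · intro h3
        exact absurd (by linarith) hzk
      · intro h3
        exact hxH h hh (by linarith)

theorem convex_halfSpaces (H : Finset (EuclideanSpace ℝ (Fin n) × ℝ)) :
    Convex ℝ {x | ∀ h ∈ H, inner ℝ h.1 x ≤ h.2} := by
  intro x hx y hy a b ha hb hab h hh
  rw [inner_add_right, inner_smul_right, inner_smul_right]
  calc a * inner ℝ h.1 x + b * inner ℝ h.1 y ≤ a * h.2 + b * h.2 :=
        add_le_add (mul_le_mul_of_nonneg_left (hx h hh) ha) (mul_le_mul_of_nonneg_left (hy h hh) hb)
    _ = h.2 := by rw [← add_mul, hab, one_mul]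

theorem isClosed_halfSpaces (H : Finset (EuclideanSpace ℝ (Fin n) × ℝ)) :
    IsClosed {x : EuclideanSpace ℝ (Fin n) | ∀ h ∈ H, inner ℝ h.1 x ≤ h.2} := by
  simp only [ofPred_forall]
  exact isClosed_biInter fun h _ => isClosed_le (by fun_prop) continuous_const

theorem IsConvexPolytope.convex {K : Set (EuclideanSpace ℝ (Fin n))} (hK : IsConvexPolytope K) :
    Convex ℝ K := by
  obtain ⟨-, -, H, rfl⟩ := hK
  exact convex_halfSpaces H

theorem IsConvexPolytope.isCompact {K : Set (EuclideanSpace ℝ (Fin n))}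
    (hK : IsConvexPolytope K) : IsCompact K := by
  obtain ⟨hb, -, H, rfl⟩ := hK
  exact Metric.isCompact_of_isClosed_isBounded (isClosed_halfSpaces H) hb

/-- An exposed face of a polytope is cut out by the constraints that are active on it. -/
theorem IsExposed.eq_setOf_active {H : Finset (EuclideanSpace ℝ (Fin n) × ℝ)}
    {K Φ : Set (EuclideanSpace ℝ (Fin n))} (hK : K = {x | ∀ h ∈ H, inner ℝ h.1 x ≤ h.2})
    (hexp : IsExposed ℝ K Φ) (hne : Φ.Nonempty) :
    Φ = {x ∈ K | ∀ h ∈ H, (∀ z ∈ Φ, inner ℝ h.1 z = h.2) → inner ℝ h.1 x = h.2} := by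
  refine Subset.antisymm (fun x hx => ⟨hexp.subset hx, fun h _ hz => hz x hx⟩) ?_
  rintro x ⟨hxK, hx⟩
  have hmemK : ∀ z, z ∈ K ↔ ∀ h ∈ H, inner ℝ h.1 z ≤ h.2 := fun z => by rw [hK]; rfl
  obtain ⟨w, hw, hwH⟩ := exists_mem_forall_inner_lt (H := H) hne
    (hexp.convex (hK ▸ convex_halfSpaces H)) fun z hz => (hmemK z).1 (hexp.subset hz)
  -- The segment from `x` can be prolonged beyond `w` inside `K`. Since `l` is maximal at `w`, this
  -- forces `l w ≤ l x`.
  have hev := eventually_add_smul_mem (u := w - x) ((hmemK w).1 (hexp.subset hw))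
    fun h hh hhw => by
      rw [inner_sub_right, hhw, hx h hh (hwH h hh hhw), sub_self]
  obtain ⟨ε, hε, hε0⟩ := ((hev.filter_mono (nhdsWithin_le_nhds (s := Ioi (0 : ℝ)))).and
    self_mem_nhdsWithin).exists
  obtain ⟨l, hl⟩ := hexp hne
  rw [hl] at hw ⊢
  refine ⟨hxK, fun z hz => (hw.2 z hz).trans ?_⟩
  have h1 := hw.2 _ ((hmemK _).2 hε)
  rw [map_add, map_smul, map_sub, smul_eq_mul] at h1
  have h2 : ε * (l w - l x) ≤ 0 := by linarith
  exact sub_nonpos.1 (nonpos_of_mul_nonpos_right h2 hε0)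

/-- A facet is determined by its set of active constraints, a subset of `H`. -/
theorem IsConvexPolytope.finite_facets {K : Set (EuclideanSpace ℝ (Fin n))}
    (hK : IsConvexPolytope K) : {Φ | IsFacet K Φ}.Finite := by
  classical
  obtain ⟨-, -, H, hH⟩ := hK
  refine Set.Finite.of_injOn
    (f := fun Φ => H.filter fun h => ∀ z ∈ Φ, inner ℝ h.1 z = h.2)
    (t := (H.powerset : Set (Finset (EuclideanSpace ℝ (Fin n) × ℝ)))) (fun Φ _ => ?_)
    (fun Φ hΦ Ψ hΨ hΦΨ => ?_) H.powerset.finite_toSet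
  · exact Finset.mem_coe.2 (Finset.mem_powerset.2 (Finset.filter_subset _ _))
  · have key : ∀ h ∈ H, (∀ z ∈ Φ, inner ℝ h.1 z = h.2) ↔ ∀ z ∈ Ψ, inner ℝ h.1 z = h.2 :=
      Finset.filter_inj'.1 hΦΨ
    rw [hΦ.2.1.eq_setOf_active hH hΦ.1, hΨ.2.1.eq_setOf_active hH hΨ.1]
    ext x
    refine and_congr_right fun _ => forall₂_congr fun h hh => ?_
    rw [key h hh]

/-- A vertex of a polytope is the unique maximizer of an affine function that decays linearly. -/
theorem IsConvexPolytope.exists_vertex_function {K : Set (EuclideanSpace ℝ (Fin n))}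
    (hK : IsConvexPolytope K) : ∃ v ∈ K, ∃ (a : EuclideanSpace ℝ (Fin n)) (b κ : ℝ), 0 < κ ∧
      inner ℝ a v + b = 1 ∧ ∀ x ∈ K, inner ℝ a x + b ∈ Icc (-1 : ℝ) 1 ∧
        κ * ‖x - v‖ ≤ 1 - (inner ℝ a x + b) := by
  classical
  have hKc := hK.isCompact
  obtain ⟨-, hKi, H, hH⟩ := hK
  have hmemK : ∀ z, z ∈ K ↔ ∀ h ∈ H, inner ℝ h.1 z ≤ h.2 := fun z => by rw [hH]; rfl
  obtain ⟨v, hv⟩ := hKc.extremePoints_nonempty (hKi.mono interior_subset)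
  have hvK := hv.1
  set A := H.filter fun h => inner ℝ h.1 v = h.2 with hA
  -- Total slack at `x` of the constraints active at `v`; the desired function is `1 - s / L`.
  set s : EuclideanSpace ℝ (Fin n) → ℝ := fun x => inner ℝ (∑ h ∈ A, h.1) (v - x) with hs
  have hssum : ∀ x ∈ K, s x = ∑ h ∈ A, |inner ℝ h.1 (x - v)| := by
    intro x hx
    simp only [hs, sum_inner]
    refine Finset.sum_congr rfl fun h hh => ?_
    rw [hA, Finset.mem_filter] at hh
    have h1 := (hmemK x).1 hx h hh.1
    rw [inner_sub_right, inner_sub_right, hh.2, abs_of_nonpos (by linarith)]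
    ring
  let T : EuclideanSpace ℝ (Fin n) →ₗ[ℝ] (A → ℝ) :=
    LinearMap.pi fun h => (innerSL ℝ h.1.1).toLinearMap
  -- A nonzero `u` in the kernel would put `v` in the middle of a segment of `K` in direction `u`,
  -- against extremality. Injectivity of `T` then gives linear growth of `s`.
  have hTker : T.ker = ⊥ := by
    rw [LinearMap.ker_eq_bot']
    intro u hu
    have hu' : ∀ h ∈ H, inner ℝ h.1 v = h.2 → inner ℝ h.1 u = 0 := fun h hh hhv =>
      congr_fun hu ⟨h, Finset.mem_filter.2 ⟨hh, hhv⟩⟩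
    have hu'' : ∀ h ∈ H, inner ℝ h.1 v = h.2 → inner ℝ h.1 (-u) = 0 := fun h hh hhv => by
      rw [inner_neg_right, hu' h hh hhv, neg_zero]
    obtain ⟨ε, ⟨h1, h2⟩, hε0⟩ := ((((eventually_add_smul_mem ((hmemK v).1 hvK) hu').and
      (eventually_add_smul_mem ((hmemK v).1 hvK) hu'')).filter_mono
        (nhdsWithin_le_nhds (s := Ioi (0 : ℝ)))).and self_mem_nhdsWithin).exists
    have h3 := (mem_extremePoints.1 hv).2 _ ((hmemK _).2 h1) _ ((hmemK _).2 h2)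
      ⟨1 / 2, 1 / 2, by norm_num, by norm_num, by norm_num, by module⟩
    have h4 : ε • u = 0 := by simpa using h3.1
    exact (smul_eq_zero.1 h4).resolve_left (ne_of_gt hε0)
  obtain ⟨C, hC, hCT⟩ := LinearMap.exists_antilipschitzWith T hTker
  have hC0 : (0 : ℝ) < C := hC
  have hlow : ∀ x ∈ K, (C : ℝ)⁻¹ * ‖x - v‖ ≤ s x := by
    intro x hx
    have h1 := hCT.le_mul_dist x v
    rw [dist_eq_norm, dist_eq_norm, ← map_sub] at h1
    have h2 : ‖T (x - v)‖ ≤ s x := by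
      rw [hssum x hx]
      refine (pi_norm_le_iff_of_nonneg (Finset.sum_nonneg fun _ _ => abs_nonneg _)).2 fun h => ?_
      exact Finset.single_le_sum (f := fun h : EuclideanSpace ℝ (Fin n) × ℝ =>
        |inner ℝ h.1 (x - v)|) (fun _ _ => abs_nonneg _) h.2
    rw [inv_mul_le_iff₀ hC0]
    exact h1.trans (mul_le_mul_of_nonneg_left h2 hC0.le)
  have hsc : Continuous s := by fun_prop
  obtain ⟨L', hL'⟩ := hKc.bddAbove_image hsc.continuousOn
  set L := max L' 1
  have hL0 : 0 < L := lt_of_lt_of_le one_pos (le_max_right _ _)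
  have e : ∀ x, inner ℝ (L⁻¹ • ∑ h ∈ A, h.1) x + (1 - L⁻¹ * inner ℝ (∑ h ∈ A, h.1) v) =
      1 - L⁻¹ * s x := by
    intro x
    simp only [hs]
    rw [real_inner_smul_left, inner_sub_right]
    ring
  refine ⟨v, hvK, L⁻¹ • ∑ h ∈ A, h.1, 1 - L⁻¹ * inner ℝ (∑ h ∈ A, h.1) v, L⁻¹ * (C : ℝ)⁻¹,
    by positivity, ?_, fun x hx => ?_⟩
  · rw [e]; simp [hs]
  · rw [e]
    have h0 : 0 ≤ s x := le_trans (by positivity) (hlow x hx)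
    have h1 : L⁻¹ * s x ≤ 1 := by
      rw [inv_mul_le_iff₀ hL0, mul_one]
      exact (hL' (mem_image_of_mem s hx)).trans (le_max_left _ _)
    have h2 : 0 ≤ L⁻¹ * s x := by positivity
    refine ⟨⟨by linarith, by linarith⟩, ?_⟩
    have := mul_le_mul_of_nonneg_left (hlow x hx) (inv_pos.2 hL0).le
    linarith

end Polytope

/-! ### The facet distance -/

/-- An antiderivative is `2σ√(α + s (β - α))`, with `σ` the sign of `β - α`. The integrand may blow
up at an endpoint, but the antiderivative is continuous there and monotone, which gives
integrability. -/
theorem lintegral_sqrt_metric_le {α β : ℝ} (hα : 0 ≤ α) (hβ : 0 ≤ β) :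
    ∫⁻ s in Icc (0 : ℝ) 1, (‖β - α‖ₑ ^ 2 / ENNReal.ofReal (α + s * (β - α))) ^ (1 / 2 : ℝ) ≤
      ENNReal.ofReal (2 * |√α - √β|) := by
  rcases eq_or_ne α β with rfl | hne
  · simp
  obtain ⟨σ, hσ, hσa⟩ : ∃ σ : ℝ, |σ| = 1 ∧ σ * (β - α) = |β - α| := by
    rcases le_total 0 (β - α) with h | h
    · exact ⟨1, by simp, by rw [abs_of_nonneg h, one_mul]⟩
    · exact ⟨-1, by simp, by rw [abs_of_nonpos h]; ring⟩
  have hpos : ∀ s ∈ Ioo (0 : ℝ) 1, 0 < α + s * (β - α) := by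
    intro s hs
    have e : α + s * (β - α) = (1 - s) * α + s * β := by ring
    rw [e]
    rcases hα.eq_or_lt with h | h
    · have : 0 < β := lt_of_le_of_ne hβ (by rwa [h])
      have := mul_pos hs.1 this
      nlinarith [hs.2]
    · have := mul_pos (sub_pos.2 hs.2) h
      nlinarith [mul_nonneg hs.1.le hβ]
  have hcont : ContinuousOn (fun s : ℝ => 2 * σ * √(α + s * (β - α))) (Icc 0 1) := by fun_prop
  have hderiv : ∀ s ∈ Ioo (0 : ℝ) 1, HasDerivAt (fun s : ℝ => 2 * σ * √(α + s * (β - α)))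
      (|β - α| / √(α + s * (β - α))) s := by
    intro s hs
    have h1 : HasDerivAt (fun s : ℝ => α + s * (β - α)) (β - α) s := by
      simpa using ((hasDerivAt_id s).mul_const (β - α)).const_add α
    have h2 := (h1.sqrt (hpos s hs).ne').const_mul (2 * σ)
    have h3 : 0 < √(α + s * (β - α)) := Real.sqrt_pos.2 (hpos s hs)
    convert! h2 using 1
    rw [← hσa]
    field_simp
  have hnn : ∀ s ∈ Ioo (0 : ℝ) 1, 0 ≤ |β - α| / √(α + s * (β - α)) := fun s _ => by positivity
  have hint := intervalIntegral.integrableOn_deriv_of_nonneg hcont hderiv hnn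
  have hFTC := intervalIntegral.integral_eq_sub_of_hasDerivAt_of_le zero_le_one hcont hderiv
    ((intervalIntegrable_iff_integrableOn_Ioc_of_le zero_le_one).2 hint)
  rw [intervalIntegral.integral_of_le zero_le_one, integral_Ioc_eq_integral_Ioo] at hFTC
  rw [setLIntegral_congr (Ioo_ae_eq_Icc (a := (0 : ℝ)) (b := 1)).symm]
  calc ∫⁻ s in Ioo (0 : ℝ) 1, (‖β - α‖ₑ ^ 2 / ENNReal.ofReal (α + s * (β - α))) ^ (1 / 2 : ℝ)
      = ∫⁻ s in Ioo (0 : ℝ) 1, ENNReal.ofReal (|β - α| / √(α + s * (β - α))) := by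
        refine setLIntegral_congr_fun measurableSet_Ioo fun s hs => ?_
        have h := hpos s hs
        rw [Real.enorm_eq_ofReal_abs, ← ENNReal.ofReal_pow (abs_nonneg _),
          ← ENNReal.ofReal_div_of_pos h, ENNReal.ofReal_rpow_of_nonneg (by positivity) (by norm_num),
          ← Real.sqrt_eq_rpow, Real.sqrt_div (by positivity), Real.sqrt_sq (abs_nonneg _)]
    _ = ENNReal.ofReal (∫ s in Ioo (0 : ℝ) 1, |β - α| / √(α + s * (β - α))) := by
        rw [ofReal_integral_eq_lintegral_ofReal (hint.mono_set Ioo_subset_Ioc_self)]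
        exact (ae_restrict_iff' measurableSet_Ioo).2 (Filter.Eventually.of_forall hnn)
    _ ≤ _ := by
        refine ENNReal.ofReal_le_ofReal ?_
        rw [hFTC]
        have e : 2 * σ * √(α + 1 * (β - α)) - 2 * σ * √(α + 0 * (β - α)) =
            2 * (σ * (√β - √α)) := by
          rw [one_mul, add_sub_cancel, zero_mul, add_zero]; ring
        rw [e, abs_sub_comm]
        have := le_abs_self (σ * (√β - √α))
        rw [abs_mul, hσ, one_mul] at this
        linarith

theorem ENNReal.finset_sum_rpow_half_le {ι : Type*} (s : Finset ι) (f : ι → ℝ≥0∞) :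
    (∑ i ∈ s, f i) ^ (1 / 2 : ℝ) ≤ ∑ i ∈ s, f i ^ (1 / 2 : ℝ) := by
  classical
  induction s using Finset.induction_on with
  | empty => simp
  | insert a s ha ih =>
    rw [Finset.sum_insert ha, Finset.sum_insert ha]
    exact (ENNReal.rpow_add_le_add_rpow _ _ (by norm_num) (by norm_num)).trans (by gcongr)

/-- The segment from `x` to `y` bounds the facet distance by the variation of the square roots of
the facet coordinates. -/
theorem facetEDist_le {n : ℕ} {K : Set (EuclideanSpace ℝ (Fin n))} (hK : Convex ℝ K)
    (hKi : (interior K).Nonempty)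
    [Fintype {Φ : Set (EuclideanSpace ℝ (Fin n)) // IsFacet K Φ}]
    {x y : EuclideanSpace ℝ (Fin n)} (hx : x ∈ K) (hy : y ∈ K) :
    facetEDist K x y ≤ ∑ Φ : {Φ : Set (EuclideanSpace ℝ (Fin n)) // IsFacet K Φ},
      ENNReal.ofReal (2 * |√(facetDist Φ.1 x) - √(facetDist Φ.1 y)|) := by
  set γ : ℝ → EuclideanSpace ℝ (Fin n) := fun s => x + s • (y - x) with hγ
  have hγd : ContDiff ℝ 1 γ := by fun_prop
  have hγK : MapsTo γ (Icc 0 1) K := fun s hs => hK.add_smul_sub_mem hx hy hs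
  have hle : facetEDist K x y ≤ facetLength K γ := by
    unfold facetEDist
    exact iInf_le_of_le γ <| iInf_le_of_le hγd.contDiffOn <| iInf_le_of_le hγK <|
      iInf_le_of_le (by simp [hγ]) <| iInf_le_of_le (by simp [hγ]) le_rfl
  refine hle.trans ?_
  choose a b hab using fun Φ : {Φ : Set (EuclideanSpace ℝ (Fin n)) // IsFacet K Φ} =>
    Φ.2.exists_facetDist_eq hKi
  have hder : ∀ s ∈ Icc (0 : ℝ) 1, derivWithin γ (Icc 0 1) s = y - x := by
    intro s hs
    have h1 : HasDerivAt γ (y - x) s := by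
      have h2 := ((hasDerivAt_id s).smul_const (y - x)).const_add x
      rwa [one_smul] at h2
    exact h1.hasDerivWithinAt.derivWithin (uniqueDiffOn_Icc zero_lt_one s hs)
  have hfd : ∀ (Φ : {Φ : Set (EuclideanSpace ℝ (Fin n)) // IsFacet K Φ}), ∀ z ∈ K,
      fderivWithin ℝ (facetDist Φ.1) K z (y - x) = facetDist Φ.1 y - facetDist Φ.1 x := by
    intro Φ z hz
    have h1 : HasFDerivAt (fun z => inner ℝ (a Φ) z + b Φ) (innerSL ℝ (a Φ)) z :=
      (innerSL ℝ (a Φ)).hasFDerivAt.add_const (b Φ)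
    rw [fderivWithin_congr (fun w hw => hab Φ w hw) (hab Φ z hz),
      h1.hasFDerivWithinAt.fderivWithin (uniqueDiffOn_convex hK hKi z hz), hab Φ y hy, hab Φ x hx,
      innerSL_apply_apply, inner_sub_right]
    ring
  have hval : ∀ (Φ : {Φ : Set (EuclideanSpace ℝ (Fin n)) // IsFacet K Φ}), ∀ s ∈ Icc (0 : ℝ) 1,
      facetDist Φ.1 (γ s) = facetDist Φ.1 x + s * (facetDist Φ.1 y - facetDist Φ.1 x) := by
    intro Φ s hs
    rw [hab Φ _ (hγK hs), hab Φ y hy, hab Φ x hx, hγ, inner_add_right, inner_smul_right,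
      inner_sub_right]
    ring
  calc facetLength K γ
      ≤ ∫⁻ s in Icc (0 : ℝ) 1, ∑ Φ : {Φ : Set (EuclideanSpace ℝ (Fin n)) // IsFacet K Φ},
          (‖facetDist Φ.1 y - facetDist Φ.1 x‖ₑ ^ 2 / ENNReal.ofReal (facetDist Φ.1 x +
            s * (facetDist Φ.1 y - facetDist Φ.1 x))) ^ (1 / 2 : ℝ) := by
        refine setLIntegral_mono' measurableSet_Icc fun s hs => ?_
        rw [facetMetric, tsum_fintype, hder s hs]
        refine (ENNReal.finset_sum_rpow_half_le _ _).trans (le_of_eq ?_)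
        refine Finset.sum_congr rfl fun Φ _ => ?_
        rw [hfd Φ _ (hγK hs), hval Φ s hs]
    _ = ∑ Φ : {Φ : Set (EuclideanSpace ℝ (Fin n)) // IsFacet K Φ}, ∫⁻ s in Icc (0 : ℝ) 1,
          (‖facetDist Φ.1 y - facetDist Φ.1 x‖ₑ ^ 2 / ENNReal.ofReal (facetDist Φ.1 x +
            s * (facetDist Φ.1 y - facetDist Φ.1 x))) ^ (1 / 2 : ℝ) :=
        lintegral_finsetSum _ fun Φ _ => by fun_prop
    _ ≤ _ := Finset.sum_le_sum fun Φ _ =>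
        lintegral_sqrt_metric_le Metric.infDist_nonneg Metric.infDist_nonneg

/-- Factor `α - β` through the square roots. If `M |√α - √β| > 2E`, then `u = M (√α + √β)` exceeds
`2E` as well, and `E (u + 1) < 2E u` contradicts the hypothesis. -/
theorem abs_sqrt_sub_sqrt_le {α β E M : ℝ} (hα : 0 ≤ α) (hβ : 0 ≤ β) (hE : 1 ≤ E) (hM : 0 < M)
    (h : |α - β| ≤ E * (√β / M + 1 / M ^ 2)) : |√α - √β| ≤ 2 * E / M := by
  have hsα := Real.sqrt_nonneg α
  have hsβ := Real.sqrt_nonneg β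
  have e : |α - β| = |√α - √β| * (√α + √β) := by
    rw [← abs_of_nonneg (add_nonneg hsα hsβ), ← abs_mul]
    congr 1
    nlinarith [Real.sq_sqrt hα, Real.sq_sqrt hβ]
  have hle : |√α - √β| ≤ √α + √β := by
    rw [abs_le]; constructor <;> linarith
  have hd := abs_nonneg (√α - √β)
  set d := |√α - √β|
  rw [e] at h
  have h' : (M * d) * (M * (√α + √β)) ≤ E * (M * √β + 1) := by
    have := mul_le_mul_of_nonneg_left h (by positivity : 0 ≤ M ^ 2)
    have e2 : M ^ 2 * (E * (√β / M + 1 / M ^ 2)) = E * (M * √β + 1) := by field_simp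
    rw [e2] at this
    linarith
  rw [le_div_iff₀ hM]
  by_contra! hc
  have h1 : M * d ≤ M * (√α + √β) := by gcongr
  have h2 : M * √β ≤ M * (√α + √β) := by gcongr; linarith
  set u := M * (√α + √β)
  have h3 : 2 * E < M * d := by linarith
  nlinarith [mul_lt_mul_of_pos_right h3 (by linarith : 0 < u)]

/-! ### Consequences for cubature formulas on polytopes -/

section Cubature

variable {n : ℕ} {K : Set (EuclideanSpace ℝ (Fin n))} {F : WeightedPoints n} {t : ℕ}

theorem WeightedPoints.IsCubature.sum_weight (hKc : IsCompact K) (hKi : (interior K).Nonempty)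
    (hF : F.IsCubature (uniformMeasure K) t) : ∑ p ∈ F.points, F.weight p = 1 := by
  have h := hF.integral_eq ((IsPolynomialFun.const 1).mono (Nat.zero_le t))
  simp only [mul_one] at h
  rw [← h, integral_uniformMeasure, setIntegral_const, smul_eq_mul, mul_one]
  exact inv_mul_cancel₀ (volume_real_pos_of_interior hKc hKi).ne'

theorem WeightedPoints.IsCubature.nonempty (hKc : IsCompact K) (hKi : (interior K).Nonempty)
    (hF : F.IsCubature (uniformMeasure K) t) : F.points.Nonempty := by
  rw [Finset.nonempty_iff_ne_empty]
  intro h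
  have := hF.sum_weight hKc hKi
  simp [h] at this

theorem support_uniformMeasure_subset (hKc : IsCompact K) : (uniformMeasure K).support ⊆ K := by
  refine Measure.support_subset_of_isClosed hKc.isClosed ?_
  rw [mem_ae_iff, uniformMeasure, ProbabilityTheory.cond, Measure.smul_apply,
    Measure.restrict_apply hKc.measurableSet.compl, compl_inter_self, measure_empty, smul_zero]

theorem points_subset_of_isInterior_or_isBoundary (hKc : IsCompact K)
    (h : F.IsInterior (uniformMeasure K) ∨ F.IsBoundary (uniformMeasure K)) :
    ∀ p ∈ F.points, p ∈ K := fun p hp =>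
  support_uniformMeasure_subset hKc (h.elim (fun h => interior_subset (h p hp)) fun h => h.1 p hp)

theorem Nat.cast_le_two_mul_mul_div {t T : ℕ} (hT : 0 < T) (htT : T ≤ t) :
    (t : ℝ) ≤ 2 * T * (t / T : ℕ) := by
  have h1 : 1 ≤ t / T := (Nat.one_le_div_iff hT).2 htT
  have h2 := Nat.lt_mul_div_succ t hT
  have h3 : t ≤ 2 * T * (t / T) := by nlinarith
  exact_mod_cast h3

theorem IsConvexPolytope.exists_isFacetNet (hK : IsConvexPolytope K) :
    ∃ C : ℝ, ∀ t : ℕ, 1 ≤ t → ∀ F : WeightedPoints n, F.IsCubature (uniformMeasure K) t →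
      F.IsPositive → (F.IsInterior (uniformMeasure K) ∨ F.IsBoundary (uniformMeasure K)) →
        F.IsFacetNet K (C / t) := by
  have hKc := hK.isCompact
  have hKi := hK.2.1
  have hconv := hK.convex
  have : Fintype {Φ : Set (EuclideanSpace ℝ (Fin n)) // IsFacet K Φ} := hK.finite_facets.fintype
  choose a b hab using fun Φ : {Φ : Set (EuclideanSpace ℝ (Fin n)) // IsFacet K Φ} =>
    Φ.2.exists_facetDist_eq hKi
  set N := Fintype.card {Φ : Set (EuclideanSpace ℝ (Fin n)) // IsFacet K Φ} with hN
  -- The added `1` ensures `L ≥ 1`, which makes `L⁻¹ x_Φ ≤ x_Φ` available for the width estimate.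
  set L := Metric.diam K + 1 with hL
  have hL1 : 1 ≤ L := by linarith [Metric.diam_nonneg (s := K)]
  have hL0 : 0 < L := by linarith
  have hdL : ∀ (Φ : {Φ : Set (EuclideanSpace ℝ (Fin n)) // IsFacet K Φ}), ∀ x ∈ K,
      facetDist Φ.1 x ≤ L := by
    intro Φ x hx
    obtain ⟨w, hw⟩ := Φ.2.1
    have h1 := Metric.infDist_le_dist_of_mem (x := x) (subset_affineSpan ℝ _ hw)
    have h2 := Metric.dist_le_diam_of_mem hKc.isBounded hx (Φ.2.2.1.subset hw)
    exact h1.trans (by linarith)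
  set A := √(kernelConst n N + 1)
  have hA1 : 1 ≤ A := Real.one_le_sqrt.2 (by linarith [kernelConst_nonneg n N])
  set E := 2 * L * A
  have hE1 : 1 ≤ E := by nlinarith
  -- Chosen so that the test polynomial for `M = t / T` has degree at most `T * M ≤ t`.
  set T := 2 + N * (2 * (n + 2)) with hT
  have hT0 : 0 < T := by omega
  have hT0' : (0 : ℝ) < T := by exact_mod_cast hT0
  set f : {Φ : Set (EuclideanSpace ℝ (Fin n)) // IsFacet K Φ} → EuclideanSpace ℝ (Fin n) → ℝ :=
    fun Φ x => inner ℝ (-(L⁻¹ • a Φ)) x + (1 - L⁻¹ * b Φ) with hf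
  have hfx : ∀ Φ, ∀ x ∈ K, f Φ x = 1 - L⁻¹ * facetDist Φ.1 x := by
    intro Φ x hx
    rw [hab Φ x hx, hf]
    simp only [inner_neg_left, real_inner_smul_left]
    ring
  have hfK : ∀ x ∈ K, ∀ Φ, f Φ x ∈ Icc (-1 : ℝ) 1 := by
    intro x hx Φ
    have h0 : 0 ≤ facetDist Φ.1 x := Metric.infDist_nonneg
    have h1 : 0 ≤ L⁻¹ * facetDist Φ.1 x := by positivity
    have h2 : L⁻¹ * facetDist Φ.1 x ≤ 1 := by
      rw [inv_mul_le_iff₀ hL0, mul_one]; exact hdL Φ x hx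
    rw [hfx Φ x hx]
    constructor <;> linarith
  have hsum : ∀ x ∈ K, ∀ y ∈ K, ∀ r : ℝ, 0 ≤ r →
      (∀ Φ : {Φ : Set (EuclideanSpace ℝ (Fin n)) // IsFacet K Φ},
        |√(facetDist Φ.1 x) - √(facetDist Φ.1 y)| ≤ r) →
      facetEDist K x y ≤ ENNReal.ofReal (N * (2 * r)) := by
    intro x hx y hy r hr h
    refine (facetEDist_le hconv hKi hx hy).trans ?_
    refine (Finset.sum_le_sum fun Φ _ => ENNReal.ofReal_le_ofReal
      (mul_le_mul_of_nonneg_left (h Φ) zero_le_two)).trans (le_of_eq ?_)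
    rw [Finset.sum_const, Finset.card_univ, nsmul_eq_mul, ENNReal.ofReal_mul (Nat.cast_nonneg N),
      ENNReal.ofReal_natCast]
  -- The second summand covers `t < T`, where any node will do because `K` has finite diameter for
  -- the facet distance.
  refine ⟨N * (2 * (2 * E)) * (2 * T) + N * (2 * √L) * T, fun t ht F hF hFp hFK x hx => ?_⟩
  have hFK' := points_subset_of_isInterior_or_isBoundary hKc hFK
  have ht0 : (0 : ℝ) < t := by exact_mod_cast ht
  rcases lt_or_ge t T with htT | htT
  · obtain ⟨p, hp⟩ := hF.nonempty hKc hKi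
    refine ⟨p, hp, (hsum x hx p (hFK' p hp) (√L) (Real.sqrt_nonneg _) fun Φ => ?_).trans
      (ENNReal.ofReal_le_ofReal ?_)⟩
    · have h1 := Real.sqrt_le_sqrt (hdL Φ x hx)
      have h2 := Real.sqrt_le_sqrt (hdL Φ p (hFK' p hp))
      have h3 := Real.sqrt_nonneg (facetDist Φ.1 x)
      have h4 := Real.sqrt_nonneg (facetDist Φ.1 p)
      rw [abs_le]; constructor <;> linarith
    · rw [le_div_iff₀ ht0]
      have h1 : (t : ℝ) ≤ T := by exact_mod_cast htT.le
      have h2 : N * (2 * √L) * t ≤ N * (2 * √L) * T := by gcongr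
      have h3 : 0 ≤ N * (2 * (2 * E)) * (2 * T) := by positivity
      linarith
  · set M := t / T with hM
    have hM1 : 1 ≤ M := (Nat.one_le_div_iff hT0).2 htT
    have hM0 : (0 : ℝ) < M := by exact_mod_cast hM1
    have hdeg : 2 + N * (2 * (n + 2) * M) ≤ t := by
      have h1 : T * M ≤ t := Nat.mul_div_le t T
      have h2 : T * M = 2 * M + N * (2 * (n + 2) * M) := by rw [hT]; ring
      omega
    obtain ⟨p, hp, hpf⟩ := exists_point_near hconv hKc hKi hf hfK hx hM1 hdeg hF hFp
    have hpK := hFK' p hp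
    refine ⟨p, hp, (hsum x hx p hpK (2 * E / M) (by positivity) fun Φ => ?_).trans
      (ENNReal.ofReal_le_ofReal ?_)⟩
    · rw [abs_sub_comm]
      have h0 : 0 ≤ facetDist Φ.1 x := Metric.infDist_nonneg
      refine abs_sqrt_sub_sqrt_le Metric.infDist_nonneg h0 hE1 hM0 ?_
      have h1 : |facetDist Φ.1 p - facetDist Φ.1 x| = L * |f Φ p - f Φ x| := by
        rw [hfx Φ p hpK, hfx Φ x hx, ← abs_of_pos hL0, ← abs_mul, abs_of_pos hL0, ← abs_neg]
        congr 1
        field_simp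
        ring
      have h2 : fejerWidth M (f Φ x) ≤ 2 * (√(facetDist Φ.1 x) / M + 1 / (M : ℝ) ^ 2) := by
        have h3 : √(1 - f Φ x ^ 2) ≤ 2 * √(facetDist Φ.1 x) := by
          rw [Real.sqrt_le_left (by positivity), mul_pow, Real.sq_sqrt h0]
          have h4 : L⁻¹ * facetDist Φ.1 x ≤ facetDist Φ.1 x :=
            mul_le_of_le_one_left h0 (inv_le_one_of_one_le₀ hL1)
          have h5 := hfx Φ x hx
          nlinarith [sq_nonneg (1 - f Φ x)]
        have h6 : 0 ≤ 1 / (M : ℝ) ^ 2 := by positivity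
        have h7 : √(1 - f Φ x ^ 2) / M ≤ 2 * √(facetDist Φ.1 x) / M := by gcongr
        rw [fejerWidth]
        rw [mul_div_assoc] at h7
        linarith
      rw [h1]
      calc L * |f Φ p - f Φ x| ≤ L * (A * (2 * (√(facetDist Φ.1 x) / M + 1 / (M : ℝ) ^ 2))) := by
            gcongr
            exact (hpf Φ).trans (by gcongr)
        _ = _ := by ring
    · have h1 := Nat.cast_le_two_mul_mul_div hT0 htT
      rw [← hM] at h1
      have h2 : N * (2 * (2 * E / M)) ≤ N * (2 * (2 * E)) * (2 * T) / t := by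
        rw [le_div_iff₀ ht0]
        calc N * (2 * (2 * E / M)) * t ≤ N * (2 * (2 * E / M)) * (2 * T * M) := by gcongr
          _ = _ := by field_simp
      refine h2.trans ?_
      gcongr
      exact le_add_of_nonneg_right (by positivity)

theorem IsConvexPolytope.exists_weight_le (hK : IsConvexPolytope K) :
    ∃ C : ℝ, ∀ t : ℕ, 1 ≤ t → ∀ F : WeightedPoints n, F.IsCubature (uniformMeasure K) t →
      F.IsPositive → ∃ p ∈ F.points, F.weight p ≤ C / (t : ℝ) ^ (2 * n) := by
  have hKc := hK.isCompact
  have hKi := hK.2.1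
  have hconv := hK.convex
  obtain ⟨v, hv, a, b, κ, hκ, hv1, hvK⟩ := hK.exists_vertex_function
  set f : Unit → EuclideanSpace ℝ (Fin n) → ℝ := fun _ x => inner ℝ a x + b with hf
  have hfv : ∀ k, f k v = 1 := fun _ => hv1
  have hfK : ∀ x ∈ K, ∀ k, f k x ∈ Icc (-1 : ℝ) 1 := fun x hx _ => (hvK x hx).1
  set m := 2 * (n + 2) with hm
  set A := √(kernelConst n (Fintype.card Unit) + 1)
  -- A node within `A / M²` of the peak must lie in the core, of size `1 / (16 R²)`, of a coarser
  -- kernel of order `R = M / B`; this needs `16 A ≤ B²`.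
  obtain ⟨B, hB⟩ := exists_nat_ge (16 * A + 1)
  have hA0 : 0 ≤ A := Real.sqrt_nonneg _
  have hB1 : (1 : ℝ) ≤ B := by linarith
  have hB0 : 0 < B := by exact_mod_cast (by linarith : (0 : ℝ) < B)
  have hBA : 16 * A ≤ (B : ℝ) ^ 2 := by nlinarith
  set T := (2 + m) * B with hT
  have hT0 : 0 < T := by positivity
  set C₀ := (volume.real K)⁻¹ * (8 ^ (m * Fintype.card Unit) * bumpConst n *
    (κ⁻¹ ^ n * volume.real (Metric.ball (0 : EuclideanSpace ℝ (Fin n)) 1)))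
  have hC0 : 0 ≤ C₀ := by
    have := bumpConst_nonneg n
    positivity
  have hw : ∀ M : ℕ, fejerWidth M 1 = 1 / (M : ℝ) ^ 2 := fun M => by simp [fejerWidth]
  refine ⟨4 ^ m * C₀ * (2 * T) ^ (2 * n) + (T : ℝ) ^ (2 * n), fun t ht F hF hFp => ?_⟩
  have ht0 : (0 : ℝ) < t := by exact_mod_cast ht
  rcases lt_or_ge t T with htT | htT
  · obtain ⟨p, hp⟩ := hF.nonempty hKc hKi
    refine ⟨p, hp, ?_⟩
    have h1 : F.weight p ≤ 1 := hF.sum_weight hKc hKi ▸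
      Finset.single_le_sum (fun q hq => (hFp q hq).le) hp
    rw [le_div_iff₀ (by positivity)]
    have h2 : (t : ℝ) ^ (2 * n) ≤ (T : ℝ) ^ (2 * n) := by gcongr
    have h3 : F.weight p * (t : ℝ) ^ (2 * n) ≤ (t : ℝ) ^ (2 * n) :=
      mul_le_of_le_one_left (by positivity) h1
    have h4 : 0 ≤ 4 ^ m * C₀ * (2 * T) ^ (2 * n) := by positivity
    linarith
  · set M := t / (2 + m) with hM
    set R := M / B with hR
    have hRT : R = t / T := by rw [hR, hM, Nat.div_div_eq_div_mul]
    have hR1 : 1 ≤ R := hRT ▸ (Nat.one_le_div_iff hT0).2 htT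
    have hR0 : (0 : ℝ) < R := by exact_mod_cast hR1
    have hRB : R * B ≤ M := Nat.div_mul_le_self M B
    have hM1 : 1 ≤ M := le_trans (Nat.mul_pos hR1 hB0) hRB
    have hM0 : (0 : ℝ) < M := by exact_mod_cast hM1
    have hRM : R ≤ M := Nat.div_le_self M B
    have hMt : M * (2 + m) ≤ t := Nat.div_mul_le_self t _
    have hMm : 2 + 1 * (m * M) ≤ t := by nlinarith
    obtain ⟨p, hp, hpf⟩ := exists_point_near hconv hKc hKi (a := fun _ : Unit => a)
      (b := fun _ => b) hf hfK hv hM1 (by simpa using hMm) hF hFp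
    refine ⟨p, hp, ?_⟩
    have hpf1 : |f () p - 1| ≤ 1 / 16 * (1 / (R : ℝ) ^ 2) := by
      have h1 := hpf ()
      rw [hfv (), hw] at h1
      refine h1.trans ?_
      have h2 : ((R : ℝ) * B) ^ 2 ≤ (M : ℝ) ^ 2 := by
        gcongr
        exact_mod_cast hRB
      rw [mul_one_div, mul_one_div, div_le_div_iff₀ (by positivity) (by positivity)]
      nlinarith [mul_le_mul_of_nonneg_left hBA (sq_nonneg (R : ℝ))]
    set q := productKernel m R f v with hq
    have hqx : ∀ x, q x = ((fejerPoly R 1).eval (f () x)) ^ m := fun x => by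
      rw [hq, productKernel, Finset.univ_unique, Finset.prod_singleton, hfv default]
    have hqp : (1 / 4 : ℝ) ^ m ≤ q p := by
      rw [hqx]
      refine pow_le_pow_left₀ (by norm_num) ?_ m
      -- The node need not lie in `K`, so `f p` may exceed `1`; Chebyshev polynomials are at least
      -- `1` there.
      rcases le_or_gt 1 (f () p) with h | h
      · linarith [one_le_eval_fejerPoly_one hR1 h]
      · have h1 : 1 / (R : ℝ) ^ 2 ≤ 1 := by
          rw [div_le_one (by positivity)]
          exact one_le_pow₀ (by exact_mod_cast hR1)
        refine le_eval_fejerPoly hR1 ⟨?_, h.le⟩ ⟨by norm_num, le_rfl⟩ ?_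
        · linarith [(abs_le.1 hpf1).1]
        · rwa [hw, div_le_iff₀ (by positivity)]
    have hqP : IsPolynomialFun t q := by
      refine (isPolynomialFun_productKernel m R
        (fun _ => IsPolynomialFun.inner_add a b) v).mono ?_
      rw [Fintype.card_unit]
      nlinarith
    have hq0 : ∀ x, 0 ≤ q x := productKernel_nonneg (even_two_mul _) R f v
    have hint : ∫ x, q x ∂uniformMeasure K ≤ C₀ * (1 / (R : ℝ) ^ 2) ^ n := by
      rw [integral_uniformMeasure, mul_assoc (volume.real K)⁻¹]
      refine mul_le_mul_of_nonneg_left ?_ (by positivity)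
      refine (productKernel_concentration hconv hKc hKi (a := fun _ : Unit => a)
        (b := fun _ => b) hf hfK hv hR1).2.1.trans ?_
      rw [mul_assoc (8 ^ (m * Fintype.card Unit) * bumpConst n)]
      refine mul_le_mul_of_nonneg_left ?_ (mul_nonneg (by positivity) (bumpConst_nonneg n))
      -- At the vertex the width is `1 / R²`, and the linear decay of `f` confines the core to a
      -- ball of radius of that order, hence volume `O(R^(-2n))`.
      have hsub : K ∩ {x | normalizedDist R f v x ≤ 1 / 16} ⊆
          Metric.closedBall v (κ⁻¹ * (1 / (R : ℝ) ^ 2)) := by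
        rintro x ⟨hxK, hx⟩
        rw [mem_ofPred_eq, normalizedDist, Finset.univ_unique, Finset.sum_singleton, hfv default, hw,
          div_le_iff₀ (by positivity)] at hx
        have h1 := (hvK x hxK).2
        have h2 := (abs_le.1 hx).1
        have h3 : f default x = inner ℝ a x + b := rfl
        have h4 : 0 < 1 / (R : ℝ) ^ 2 := by positivity
        rw [mem_closedBall_iff_norm, ← div_eq_inv_mul, le_div_iff₀ hκ]
        linarith
      refine (measureReal_mono hsub measure_closedBall_lt_top.ne).trans (le_of_eq ?_)
      rw [measureReal_def, Measure.addHaar_closedBall _ _ (by positivity), ENNReal.toReal_mul,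
        ENNReal.toReal_ofReal (by positivity), finrank_euclideanSpace_fin, measureReal_def, mul_pow]
      ring
    rw [hF.integral_eq hqP] at hint
    have h1 : F.weight p * q p ≤ C₀ * (1 / (R : ℝ) ^ 2) ^ n :=
      (Finset.single_le_sum (f := fun p => F.weight p * q p)
        (fun r hr => mul_nonneg (hFp r hr).le (hq0 r)) hp).trans hint
    have h2 : F.weight p ≤ 4 ^ m * C₀ * (1 / (R : ℝ) ^ 2) ^ n := by
      have h3 := (mul_le_mul_of_nonneg_left hqp (hFp p hp).le).trans h1
      rw [one_div, inv_pow, ← div_eq_mul_inv, div_le_iff₀ (by positivity)] at h3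
      linarith
    have h4 : (t : ℝ) ^ (2 * n) ≤ (2 * T) ^ (2 * n) * (R : ℝ) ^ (2 * n) := by
      rw [← mul_pow, hRT]
      exact pow_le_pow_left₀ ht0.le (Nat.cast_le_two_mul_mul_div hT0 htT) _
    rw [le_div_iff₀ (by positivity)]
    calc F.weight p * (t : ℝ) ^ (2 * n) ≤
          4 ^ m * C₀ * (1 / (R : ℝ) ^ 2) ^ n * ((2 * T) ^ (2 * n) * (R : ℝ) ^ (2 * n)) := by
          gcongr
      _ = 4 ^ m * C₀ * (2 * T) ^ (2 * n) := by
          rw [one_div, inv_pow, ← pow_mul]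
          field_simp
      _ ≤ _ := le_add_of_nonneg_right (by positivity)

end Cubature

/-! ### The three statements together -/

theorem mainTheorem12 {n : ℕ} (K : Set (EuclideanSpace ℝ (Fin n))) (hK : IsConvexPolytope K) :
    (IsSimple K → ∃ C : ℝ, ∀ t : ℕ, 1 ≤ t → ∀ F : WeightedPoints n,
      F.IsCubature (uniformMeasure K) t → F.IsPositive →
      (F.IsInterior (uniformMeasure K) ∨ F.IsBoundary (uniformMeasure K)) →
        F.IsFacetNet K (C / t)) ∧
    (∃ C : ℝ, ∀ t : ℕ, 1 ≤ t → ∀ F : WeightedPoints n,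
      F.IsCubature (uniformMeasure K) t → F.IsPositive →
        ∃ p ∈ F.points, (∀ q ∈ F.points, F.weight p ≤ F.weight q) ∧
          F.weight p ≤ C / (t : ℝ) ^ (2 * n)) ∧
    (∃ c : ℝ, 0 < c ∧ ∀ t : ℕ, 1 ≤ t → ∀ F : WeightedPoints n,
      F.IsDesign (uniformMeasure K) t → c * (t : ℝ) ^ (2 * n) ≤ F.points.card) := by
  have hKc := hK.isCompact
  have hKi := hK.2.1
  obtain ⟨C, hC⟩ := hK.exists_weight_le
  refine ⟨fun _ => hK.exists_isFacetNet, ⟨C, fun t ht F hF hFp => ?_⟩,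
    (max C 1)⁻¹, by positivity, fun t ht F hF => ?_⟩
  · obtain ⟨p, hp, hpC⟩ := hC t ht F hF hFp
    obtain ⟨p₀, hp₀, hmin⟩ := F.points.exists_min_image F.weight ⟨p, hp⟩
    exact ⟨p₀, hp₀, hmin, (hmin p hp).trans hpC⟩
  · have ht0 : (0 : ℝ) < t := by exact_mod_cast ht
    obtain ⟨hFc, hFe, -⟩ := hF
    -- Equal weights summing to `1` are automatically positive, so the weight bound applies to
    -- designs.
    have hcard : ∀ p ∈ F.points, F.points.card * F.weight p = 1 := by
      intro p hp
      rw [← hFc.sum_weight hKc hKi, Finset.sum_congr rfl fun q hq => hFe q hq p hp,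
        Finset.sum_const, nsmul_eq_mul]
    have hFp : F.IsPositive := fun p hp => by
      by_contra! h
      have := mul_nonpos_of_nonneg_of_nonpos (Nat.cast_nonneg (α := ℝ) F.points.card) h
      linarith [hcard p hp]
    obtain ⟨p, hp, hpC⟩ := hC t ht F hFc hFp
    have hC1 : 0 < max C 1 := lt_of_lt_of_le one_pos (le_max_right _ _)
    rw [inv_mul_le_iff₀ hC1]
    rw [le_div_iff₀ (by positivity)] at hpC
    have h1 : (t : ℝ) ^ (2 * n) = F.points.card * (F.weight p * (t : ℝ) ^ (2 * n)) := by
      rw [← mul_assoc, hcard p hp, one_mul]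
    rw [h1, mul_comm (max C 1)]
    exact mul_le_mul_of_nonneg_left (hpC.trans (le_max_left _ _)) (Nat.cast_nonneg _)
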